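/- Let $d\ge 1$ and let $\Omega\subset\mathbb R^d$ be a bounded open set with Lipschitz boundary and outward unit normal $n$. Let $a:\Omega\to\mathbb R$ be measurable with $\alpha\le a\le\beta$ almost everywhere in $\Omega$, where $0<\alpha\le\beta<\infty$, and let $\widetilde\Omega$ be an open set with $\overline{\widetilde\Omega}\subset\Omega$. Let $H^{1/2}(\partial\Omega)\subset L^2(\partial\Omega)$ be the space of traces of functions in $H^1(\Omega)$, with the norm $\|f\|_{H^{1/2}(\partial\Omega)}=\inf\{\|u\|_{H^1(\Omega)}:u|_{\partial\Omega}=f\}$, and let $H^{-1/2}(\partial\Omega)$ be its dual space. For $v\in H^1(\Omega)$ with $\nabla\cdot(a\nabla v)\in L^2(\Omega)$ (in the weak sense), the boundary flux $a\frac{\partial v}{\partial n}\in H^{-1/2}(\partial\Omega)$ is the normal trace of $a\nabla v$, i.e. the functional $$\Big\langle a\frac{\partial v}{\partial n},F|_{\partial\Omega}\Big\rangle_{\partial\Omega}=\int_\Omega \big(a\nabla v\cdot\nabla F+F\,\nabla\cdot(a\nabla v)\big)\,dx,\qquad F\in H^1(\Omega).$$ Then the following hold. 1. For every $f\in H^{1/2}(\partial\Omega)$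 the problem $$\nabla\cdot(a\nabla u)=0\ \text{ in }\Omega,\qquad u=f\ \text{ on }\partial\Omega$$ has exactly one weak solution $u\in H^1(\Omega)$, and $\widetilde{\mathcal S}f:=u|_{\widetilde\Omega}$ defines a continuous linear operator $\widetilde{\mathcal S}:H^{1/2}(\partial\Omega)\to H^1(\widetilde\Omega)$. 2. For every $g\in H^1(\widetilde\Omega)$, with $\tilde g$ the extension of $g$ by zero to $\Omega$, the problem $$\nabla\cdot(a\nabla v)=\tilde g\ \text{ in }\Omega,\qquad v=0\ \text{ on }\partial\Omega$$ has exactly one weak solution $v\in H^1(\Omega)$, and $\widetilde{\mathcal S}^*g:=a\frac{\partial v}{\partial n}$ defines a continuous linear operator $\widetilde{\mathcal S}^*:H^1(\widetilde\Omega)\to H^{-1/2}(\partial\Omega)$. 3. For all $f\in H^{1/2}(\partial\Omega)$ and $g\in H^1(\widetilde\Omega)$, $$\langle g,\widetilde{\mathcal S}f\rangle_{\widetilde\Omega}=\langle\widetilde{\mathcal S}^*g,f\rangle_{\partial\Omega},$$ where $\langle\cdot,\cdot\rangle_{\widetilde\Omega}$ is the $L^2(\widetilde\Omega)$ pairing and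 $\langle\cdot,\cdot\rangle_{\partial\Omega}$ is the pairing of $H^{-1/2}(\partial\Omega)$ with $H^{1/2}(\partial\Omega)$. -/

import Mathlib

open MeasureTheory Set Filter Topology
open scoped ContDiff ENNReal Gradient

noncomputable section

namespace AdjointMap

/-- Euclidean space `ℝ^d`. -/
abbrev Rn (d : ℕ) : Type := EuclideanSpace ℝ (Fin d)

/-- `Ω` has a Lipschitz boundary: near every boundary point, in the direction of some unit vector
`e`, the set `Ω` is the strict epigraph of a Lipschitz function of the component of the point
orthogonal to `e`. -/
def HasLipschitzBoundary {d : ℕ} (Ω : Set (Rn d)) : Prop :=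
  ∀ x ∈ frontier Ω, ∃ (U : Set (Rn d)) (e : Rn d) (K : NNReal) (γ : Rn d → ℝ),
    IsOpen U ∧ x ∈ U ∧ ‖e‖ = 1 ∧ LipschitzWith K γ ∧
      Ω ∩ U = {y ∈ U | γ (y - inner ℝ e y • e) < inner ℝ e y}

/-- The surface measure on `∂Ω`: the `(d-1)`-dimensional Hausdorff measure, normalized so as to
agree with Lebesgue measure on `(d-1)`-dimensional subspaces, restricted to `∂Ω`. -/
def surfaceMeasure {d : ℕ} (Ω : Set (Rn d)) : Measure (Rn d) :=
  (Measure.euclideanHausdorffMeasure (d - 1)).restrict (frontier Ω)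

/-- `L²(Ω)`. -/
abbrev L2 {d : ℕ} (Ω : Set (Rn d)) : Type := Lp ℝ 2 (volume.restrict Ω)

/-- `L²(Ω)^d`. -/
abbrev L2vec {d : ℕ} (Ω : Set (Rn d)) : Type := Lp (Rn d) 2 (volume.restrict Ω)

/-- `L²(∂Ω)`, with respect to surface measure. -/
abbrev L2bdry {d : ℕ} (Ω : Set (Rn d)) : Type := Lp ℝ 2 (surfaceMeasure Ω)

/-- `φ ∈ C_c^∞(Ω)`. -/
structure IsTestFunction {d : ℕ} (Ω : Set (Rn d)) (φ : Rn d → ℝ) : Prop where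
  smooth : ContDiff ℝ ∞ φ
  compact : HasCompactSupport φ
  support_subset : tsupport φ ⊆ Ω

/-- `G` is the weak gradient of `u` in `Ω`. -/
def IsWeakGradient {d : ℕ} (Ω : Set (Rn d)) (u : Rn d → ℝ) (G : Rn d → Rn d) : Prop :=
  ∀ φ : Rn d → ℝ, IsTestFunction Ω φ →
    ∫ x in Ω, u x • ∇ φ x = - ∫ x in Ω, φ x • G x

/-- `h` is the weak (distributional) divergence of the vector field `q` in `Ω`. -/
def IsWeakDivergence {d : ℕ} (Ω : Set (Rn d)) (q : Rn d → Rn d) (h : Rn d → ℝ) : Prop :=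
  ∀ φ : Rn d → ℝ, IsTestFunction Ω φ →
    ∫ x in Ω, inner ℝ (q x) (∇ φ x) = - ∫ x in Ω, h x * φ x

theorem continuous_gradient_of_smooth {d : ℕ} {φ : Rn d → ℝ} (h : ContDiff ℝ ∞ φ) :
    Continuous (∇ φ) :=
  (InnerProductSpace.toDual ℝ (Rn d)).symm.continuous.comp (h.continuous_fderiv (by simp))

theorem IsTestFunction.memLp {d : ℕ} {Ω : Set (Rn d)} {φ : Rn d → ℝ} (h : IsTestFunction Ω φ) :
    MemLp φ 2 (volume.restrict Ω) :=
  (h.smooth.continuous.memLp_of_hasCompactSupport h.compact).restrict Ω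

theorem IsTestFunction.memLp_gradient {d : ℕ} {Ω : Set (Rn d)} {φ : Rn d → ℝ}
    (h : IsTestFunction Ω φ) : MemLp (∇ φ) 2 (volume.restrict Ω) := by
  refine MemLp.restrict Ω ((continuous_gradient_of_smooth h.smooth).memLp_of_hasCompactSupport ?_)
  exact (h.compact.fderiv (𝕜 := ℝ)).comp_left (g := (InnerProductSpace.toDual ℝ (Rn d)).symm)
    (map_zero _)

theorem integrable_smul_of_memLp {d : ℕ} {Ω : Set (Rn d)} {u : Rn d → ℝ} {G : Rn d → Rn d}
    (hu : MemLp u 2 (volume.restrict Ω)) (hG : MemLp G 2 (volume.restrict Ω)) :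
    Integrable (fun x => u x • G x) (volume.restrict Ω) :=
  memLp_one_iff_integrable.1 (hG.smul hu)

/-- The Sobolev space `H¹(Ω)`, as a subspace of `L²(Ω) × L²(Ω)^d`: the pairs `(u, ∇u)` of a function `u ∈ L²(Ω)` and its weak gradient
`∇u ∈ L²(Ω)^d` (which `u` determines), with the inner product
`∫_Ω u v + ∫_Ω ∇u · ∇v` that it inherits from `L²(Ω) × L²(Ω)^d`. -/
def sobolevSpace {d : ℕ} (Ω : Set (Rn d)) : Submodule ℝ (WithLp 2 (L2 Ω × L2vec Ω)) where
  carrier := {p | IsWeakGradient Ω p.fst p.snd}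
  zero_mem' := by
    intro φ _
    have h1 : ((0 : L2 Ω) : Rn d → ℝ) =ᵐ[volume.restrict Ω] 0 := Lp.coeFn_zero _ _ _
    have h2 : ((0 : L2vec Ω) : Rn d → Rn d) =ᵐ[volume.restrict Ω] 0 := Lp.coeFn_zero _ _ _
    have e1 : ∫ x in Ω, ((0 : L2 Ω) : Rn d → ℝ) x • ∇ φ x = 0 :=
      integral_eq_zero_of_ae (by filter_upwards [h1] with x hx; rw [hx]; simp)
    have e2 : ∫ x in Ω, φ x • ((0 : L2vec Ω) : Rn d → Rn d) x = 0 :=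
      integral_eq_zero_of_ae (by filter_upwards [h2] with x hx; rw [hx]; simp)
    exact e1.trans (neg_eq_zero.2 e2).symm
  add_mem' := by
    intro p q hp hq φ hφ
    have h1 := Lp.coeFn_add p.fst q.fst
    have h2 := Lp.coeFn_add p.snd q.snd
    have e1 : ∫ x in Ω, (p + q).fst x • ∇ φ x
        = ∫ x in Ω, (p.fst x • ∇ φ x + q.fst x • ∇ φ x) :=
      integral_congr_ae (by
        filter_upwards [h1] with x hx
        rw [WithLp.add_fst, hx, Pi.add_apply, add_smul])
    have e2 : ∫ x in Ω, φ x • (p + q).snd x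
        = ∫ x in Ω, (φ x • p.snd x + φ x • q.snd x) :=
      integral_congr_ae (by
        filter_upwards [h2] with x hx
        rw [WithLp.add_snd, hx, Pi.add_apply, smul_add])
    rw [e1, e2,
      integral_add (integrable_smul_of_memLp (Lp.memLp _) hφ.memLp_gradient)
        (integrable_smul_of_memLp (Lp.memLp _) hφ.memLp_gradient),
      integral_add (integrable_smul_of_memLp hφ.memLp (Lp.memLp _))
        (integrable_smul_of_memLp hφ.memLp (Lp.memLp _)), hp φ hφ, hq φ hφ, neg_add]
  smul_mem' := by
    intro c p hp φ hφ
    have h1 := Lp.coeFn_smul c p.fst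
    have h2 := Lp.coeFn_smul c p.snd
    have e1 : ∫ x in Ω, (c • p).fst x • ∇ φ x = ∫ x in Ω, c • (p.fst x • ∇ φ x) :=
      integral_congr_ae (by
        filter_upwards [h1] with x hx
        rw [WithLp.smul_fst, hx, Pi.smul_apply, smul_assoc])
    have e2 : ∫ x in Ω, φ x • (c • p).snd x = ∫ x in Ω, c • (φ x • p.snd x) :=
      integral_congr_ae (by
        filter_upwards [h2] with x hx
        rw [WithLp.smul_snd, hx, Pi.smul_apply, smul_comm])
    rw [e1, e2, integral_smul, integral_smul, hp φ hφ, smul_neg]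

/-- `H¹(Ω)`. -/
abbrev H1 {d : ℕ} (Ω : Set (Rn d)) : Type := sobolevSpace Ω

/-- The function underlying an element of `H¹(Ω)`. -/
def H1.fn {d : ℕ} {Ω : Set (Rn d)} (u : H1 Ω) : Rn d → ℝ := u.1.fst

/-- The weak gradient of an element of `H¹(Ω)`. -/
def H1.grad {d : ℕ} {Ω : Set (Rn d)} (u : H1 Ω) : Rn d → Rn d := u.1.snd

/-- `u ∈ H¹(Ω)` has the trace `f ∈ L²(∂Ω)` on `∂Ω`: there are smooth functions `φₙ` on `ℝ^d` with
`φₙ → u` in `H¹(Ω)` and `φₙ|_{∂Ω} → f` in `L²(∂Ω)`. (For a bounded Lipschitz domain this is the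
graph of the trace operator, the continuous extension of `φ ↦ φ|_{∂Ω}` to `H¹(Ω)`.) -/
def HasTrace {d : ℕ} {Ω : Set (Rn d)} (u : H1 Ω) (f : L2bdry Ω) : Prop :=
  ∃ φ : ℕ → Rn d → ℝ, (∀ n, ContDiff ℝ ∞ (φ n)) ∧
    Tendsto (fun n => eLpNorm (φ n - u.fn) 2 (volume.restrict Ω)) atTop (𝓝 0) ∧
    Tendsto (fun n => eLpNorm (∇ (φ n) - u.grad) 2 (volume.restrict Ω)) atTop (𝓝 0) ∧
    Tendsto (fun n => eLpNorm (φ n - (f : Rn d → ℝ)) 2 (surfaceMeasure Ω)) atTop (𝓝 0)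

theorem tendsto_eLpNorm_add {d : ℕ} {E : Type*} [NormedAddCommGroup E] {μ : Measure (Rn d)}
    {φ ψ : ℕ → Rn d → E} (u v : Lp E 2 μ)
    (hφ : ∀ n, AEStronglyMeasurable (φ n) μ) (hψ : ∀ n, AEStronglyMeasurable (ψ n) μ)
    (h1 : Tendsto (fun n => eLpNorm (φ n - (u : Rn d → E)) 2 μ) atTop (𝓝 0))
    (h2 : Tendsto (fun n => eLpNorm (ψ n - (v : Rn d → E)) 2 μ) atTop (𝓝 0)) :
    Tendsto (fun n => eLpNorm (φ n + ψ n - ((u + v : Lp E 2 μ) : Rn d → E)) 2 μ) atTop (𝓝 0) := by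
  have h3 := h1.add h2
  rw [add_zero] at h3
  refine tendsto_of_tendsto_of_tendsto_of_le_of_le tendsto_const_nhds h3 (fun _ => zero_le)
    (fun n => ?_)
  have e : φ n + ψ n - ((u + v : Lp E 2 μ) : Rn d → E) =ᵐ[μ] (φ n - (u : Rn d → E)) + (ψ n - (v : Rn d → E)) := by
    filter_upwards [Lp.coeFn_add u v] with x hx
    simp only [Pi.sub_apply, Pi.add_apply, hx]
    abel
  change eLpNorm (φ n + ψ n - ((u + v : Lp E 2 μ) : Rn d → E)) 2 μ ≤ _
  rw [eLpNorm_congr_ae e]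
  exact eLpNorm_add_le ((hφ n).sub (Lp.aestronglyMeasurable u))
    ((hψ n).sub (Lp.aestronglyMeasurable v)) (by norm_num)

theorem tendsto_eLpNorm_smul {d : ℕ} {E : Type*} [NormedAddCommGroup E] [NormedSpace ℝ E]
    {μ : Measure (Rn d)} {φ : ℕ → Rn d → E} (c : ℝ) (u : Lp E 2 μ)
    (h1 : Tendsto (fun n => eLpNorm (φ n - (u : Rn d → E)) 2 μ) atTop (𝓝 0)) :
    Tendsto (fun n => eLpNorm (c • φ n - ((c • u : Lp E 2 μ) : Rn d → E)) 2 μ) atTop (𝓝 0) := by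
  have h3 := ENNReal.Tendsto.const_mul (a := ‖c‖ₑ) h1 (Or.inr (by simp))
  rw [mul_zero] at h3
  refine h3.congr (fun n => ?_)
  have e : c • φ n - ((c • u : Lp E 2 μ) : Rn d → E) =ᵐ[μ] c • (φ n - (u : Rn d → E)) := by
    filter_upwards [Lp.coeFn_smul c u] with x hx
    simp only [Pi.sub_apply, Pi.smul_apply, hx, smul_sub]
  rw [eLpNorm_congr_ae e, eLpNorm_const_smul]

theorem gradient_add_of_smooth {d : ℕ} {φ ψ : Rn d → ℝ} (hφ : ContDiff ℝ ∞ φ)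
    (hψ : ContDiff ℝ ∞ ψ) : ∇ (φ + ψ) = ∇ φ + ∇ ψ := by
  funext x
  simp only [gradient, Pi.add_apply]
  rw [fderiv_add (hφ.differentiable (by simp) x) (hψ.differentiable (by simp) x), map_add]

theorem gradient_smul_of_smooth {d : ℕ} {φ : Rn d → ℝ} (c : ℝ) (hφ : ContDiff ℝ ∞ φ) :
    ∇ (c • φ) = c • ∇ φ := by
  funext x
  simp only [gradient, Pi.smul_apply]
  rw [fderiv_const_smul (hφ.differentiable (by simp) x)]
  simp

theorem HasTrace.add {d : ℕ} {Ω : Set (Rn d)} {u v : H1 Ω} {f g : L2bdry Ω}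
    (hu : HasTrace u f) (hv : HasTrace v g) : HasTrace (u + v) (f + g) := by
  obtain ⟨φ, hφ, h1, h2, h3⟩ := hu
  obtain ⟨ψ, hψ, k1, k2, k3⟩ := hv
  refine ⟨fun n => φ n + ψ n, fun n => (hφ n).add (hψ n), ?_, ?_, ?_⟩
  · exact tendsto_eLpNorm_add u.1.fst v.1.fst
      (fun n => (hφ n).continuous.aestronglyMeasurable)
      (fun n => (hψ n).continuous.aestronglyMeasurable) h1 k1
  · have := tendsto_eLpNorm_add u.1.snd v.1.snd
      (fun n => (continuous_gradient_of_smooth (hφ n)).aestronglyMeasurable)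
      (fun n => (continuous_gradient_of_smooth (hψ n)).aestronglyMeasurable) h2 k2
    refine this.congr (fun n => ?_)
    rw [gradient_add_of_smooth (hφ n) (hψ n)]
    rfl
  · exact tendsto_eLpNorm_add f g
      (fun n => (hφ n).continuous.aestronglyMeasurable)
      (fun n => (hψ n).continuous.aestronglyMeasurable) h3 k3

theorem HasTrace.smul {d : ℕ} {Ω : Set (Rn d)} (c : ℝ) {u : H1 Ω} {f : L2bdry Ω}
    (hu : HasTrace u f) : HasTrace (c • u) (c • f) := by
  obtain ⟨φ, hφ, h1, h2, h3⟩ := hu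
  refine ⟨fun n => c • φ n, fun n => (hφ n).const_smul c, ?_, ?_, ?_⟩
  · exact tendsto_eLpNorm_smul c u.1.fst h1
  · refine (tendsto_eLpNorm_smul c u.1.snd h2).congr (fun n => ?_)
    rw [gradient_smul_of_smooth c (hφ n)]
    rfl
  · exact tendsto_eLpNorm_smul c f h3

theorem hasTrace_zero {d : ℕ} {Ω : Set (Rn d)} : HasTrace (0 : H1 Ω) 0 := by
  have h0 : ∇ (0 : Rn d → ℝ) = 0 := by
    simpa using gradient_smul_of_smooth (d := d) (φ := 0) (0 : ℝ) contDiff_const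
  have key : ∀ {E : Type} [NormedAddCommGroup E] (μ : Measure (Rn d)),
      eLpNorm ((0 : Rn d → E) - ((0 : Lp E 2 μ) : Rn d → E)) 2 μ = 0 := by
    intro E _ μ
    have e : (0 : Rn d → E) - ((0 : Lp E 2 μ) : Rn d → E) =ᵐ[μ] 0 := by
      filter_upwards [Lp.coeFn_zero E 2 μ] with x hx
      rw [Pi.sub_apply, hx, sub_self]
      rfl
    rw [eLpNorm_congr_ae e, eLpNorm_zero]
  refine ⟨fun _ => 0, fun _ => contDiff_const, ?_, ?_, ?_⟩
  · exact tendsto_const_nhds.congr (fun n => (key _).symm)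
  · refine tendsto_const_nhds.congr (fun n => ?_)
    rw [h0]
    exact (key _).symm
  · exact tendsto_const_nhds.congr (fun n => (key _).symm)

/-- The functions in `L²(∂Ω)` that are traces of elements of `H¹(Ω)`. -/
def traceRange {d : ℕ} (Ω : Set (Rn d)) : Submodule ℝ (L2bdry Ω) where
  carrier := {f | ∃ u : H1 Ω, HasTrace u f}
  zero_mem' := ⟨0, hasTrace_zero⟩
  add_mem' := fun ⟨u, hu⟩ ⟨v, hv⟩ => ⟨u + v, hu.add hv⟩
  smul_mem' := fun c _ ⟨u, hu⟩ => ⟨c • u, hu.smul c⟩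

/-- The space `H^{1/2}(∂Ω)`: the range of the trace operator on `H¹(Ω)`, normed below by
`‖f‖ = inf {‖u‖_{H¹(Ω)} : u has trace f}`. -/
def HHalf {d : ℕ} (Ω : Set (Rn d)) : Type := traceRange Ω

namespace HHalf

variable {d : ℕ} {Ω : Set (Rn d)}

instance : AddCommGroup (HHalf Ω) := inferInstanceAs (AddCommGroup (traceRange Ω))

instance : Module ℝ (HHalf Ω) := inferInstanceAs (Module ℝ (traceRange Ω))

/-- The underlying element of `L²(∂Ω)`. -/
def val (f : HHalf Ω) : L2bdry Ω := Subtype.val (p := fun g => g ∈ traceRange Ω) f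

/-- `inf {‖u‖_{H¹(Ω)} : u has trace f}`. -/
def traceNorm (f : HHalf Ω) : ℝ := sInf {r : ℝ | ∃ u : H1 Ω, HasTrace u f.val ∧ ‖u‖ = r}

theorem traceNorm_le {f : HHalf Ω} {u : H1 Ω} (hu : HasTrace u f.val) : traceNorm f ≤ ‖u‖ :=
  csInf_le ⟨0, by rintro r ⟨w, -, rfl⟩; exact norm_nonneg w⟩ ⟨u, hu, rfl⟩

theorem exists_norm_lt (f : HHalf Ω) {ε : ℝ} (hε : 0 < ε) :
    ∃ u : H1 Ω, HasTrace u f.val ∧ ‖u‖ < traceNorm f + ε := by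
  have hf : ∃ u : H1 Ω, HasTrace u f.val :=
    Subtype.property (p := fun g => g ∈ traceRange Ω) f
  obtain ⟨w, hw⟩ := hf
  have hne : {r : ℝ | ∃ u : H1 Ω, HasTrace u f.val ∧ ‖u‖ = r}.Nonempty := ⟨_, w, hw, rfl⟩
  obtain ⟨r, ⟨u, hu, rfl⟩, hlt⟩ :=
    exists_lt_of_csInf_lt hne (lt_add_of_pos_right (traceNorm f) hε)
  exact ⟨u, hu, hlt⟩

theorem traceNorm_nonneg (f : HHalf Ω) : 0 ≤ traceNorm f :=
  Real.sInf_nonneg (by rintro r ⟨w, -, rfl⟩; exact norm_nonneg w)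

/-- The norm of `H^{1/2}(∂Ω)`, as a seminorm. -/
def traceSeminorm (Ω : Set (Rn d)) : Seminorm ℝ (HHalf Ω) :=
  Seminorm.ofSMulLE traceNorm
    (le_antisymm (by
      have h : HasTrace (0 : H1 Ω) (val (0 : HHalf Ω)) := hasTrace_zero
      simpa using traceNorm_le h) (traceNorm_nonneg _))
    (fun f g => by
      refine le_of_forall_pos_le_add (fun ε hε => ?_)
      obtain ⟨u, hu, hu'⟩ := exists_norm_lt f (half_pos hε)
      obtain ⟨v, hv, hv'⟩ := exists_norm_lt g (half_pos hε)
      have h : HasTrace (u + v) (val (f + g)) := hu.add hv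
      linarith [traceNorm_le h, norm_add_le u v])
    (fun c f => by
      refine le_of_forall_pos_le_add (fun ε hε => ?_)
      obtain ⟨u, hu, hu'⟩ := exists_norm_lt f (ε := ε / (‖c‖ + 1)) (by positivity)
      have h : HasTrace (c • u) (val (c • f)) := hu.smul c
      have h1 := traceNorm_le h
      rw [norm_smul] at h1
      have h2 : ‖c‖ * ‖u‖ ≤ ‖c‖ * (traceNorm f + ε / (‖c‖ + 1)) :=
        mul_le_mul_of_nonneg_left hu'.le (norm_nonneg c)
      have h3 : ‖c‖ * (ε / (‖c‖ + 1)) ≤ ε := by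
        rw [mul_div_assoc', div_le_iff₀ (by positivity)]
        nlinarith
      linarith [mul_add ‖c‖ (traceNorm f) (ε / (‖c‖ + 1))])

/-- For a bounded Lipschitz domain this seminorm is a norm, by continuity of the trace. -/
instance : SeminormedAddCommGroup (HHalf Ω) :=
  (traceSeminorm Ω).toAddGroupSeminorm.toSeminormedAddCommGroup

instance : NormedSpace ℝ (HHalf Ω) where
  norm_smul_le c f := (map_smul_eq_mul (traceSeminorm Ω) c f).le

end HHalf

/-- `H^{-1/2}(∂Ω)`: the space of continuous linear functionals on `H^{1/2}(∂Ω)`, with the dual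
norm. The pairing `⟨ℓ, f⟩_{∂Ω}` of `H^{-1/2}(∂Ω)` with `H^{1/2}(∂Ω)` is `ℓ f`. -/
abbrev HNegHalf {d : ℕ} (Ω : Set (Rn d)) : Type := HHalf Ω →L[ℝ] ℝ

/-- `u ∈ H¹(Ω)` is the weak solution of `∇ · (a ∇u) = h` in `Ω`, `u = f` on `∂Ω`. -/
def IsDirichletSolution {d : ℕ} {Ω : Set (Rn d)} (a : Rn d → ℝ) (h : Rn d → ℝ) (f : HHalf Ω)
    (u : H1 Ω) : Prop :=
  IsWeakDivergence Ω (fun x => a x • u.grad x) h ∧ HasTrace u f.val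

/-- `ℓ ∈ H^{-1/2}(∂Ω)` is the normal trace `q · n` on `∂Ω` (`n` the outward unit normal) of a
vector field `q` with `q ∈ L²(Ω)^d` and weak divergence `div q ∈ L²(Ω)`, that is,
`⟨ℓ, F|_{∂Ω}⟩ = ∫_Ω (q · ∇F + (div q) F)` for all `F ∈ H¹(Ω)`. -/
def IsNormalTrace {d : ℕ} (Ω : Set (Rn d)) (q : Rn d → Rn d) (ℓ : HNegHalf Ω) : Prop :=
  MemLp q 2 (volume.restrict Ω) ∧
  ∃ h : Rn d → ℝ, MemLp h 2 (volume.restrict Ω) ∧ IsWeakDivergence Ω q h ∧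
    ∀ (f : HHalf Ω) (F : H1 Ω), HasTrace F f.val →
      ℓ f = ∫ x in Ω, (inner ℝ (q x) (F.grad x) + h x * F.fn x)

/-- `ℓ = a ∂v/∂n` on `∂Ω`, the boundary flux (conormal derivative) of `v ∈ H¹(Ω)`. -/
def IsBoundaryFlux {d : ℕ} {Ω : Set (Rn d)} (a : Rn d → ℝ) (v : H1 Ω) (ℓ : HNegHalf Ω) : Prop :=
  IsNormalTrace Ω (fun x => a x • v.grad x) ℓ

/-- The extension of a function on `Ω'` by zero. -/
def zeroExtension {d : ℕ} {Ω' : Set (Rn d)} (g : H1 Ω') : Rn d → ℝ := Ω'.indicator g.fn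

end AdjointMap

end

noncomputable section

namespace AdjointMap

/-! ### Integration by parts, completeness of `H1`, the space `H10`, and Poincaré's inequality. -/

section Basics

variable {d : ℕ} {Ω : Set (Rn d)}

/-! Write B(u,w) = ∫_Ω a∇u·∇w. On `H10`, the closure of the test functions in `H1`, Poincaré's
inequality makes B coercive, and Lax–Milgram solves both Dirichlet problems there
(`energyForm_coercive`, `exists_laxMilgram_solver`). With E a bounded linear lift of traces
(`exists_traceLift`), the first solution is u = Ef − w, where w ∈ `H10` satisfies B(w,·) = B(Ef,·)
on `H10`; the second is v ∈ `H10` with B(v,·) = −∫g· on `H10`. The flux is f ↦ B(v,Ef) + ∫gEf. It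
does not depend on the lift, because two lifts differ by an element of `H10`, on which this
functional vanishes. The adjoint identity then comes from the symmetry of B: B(v,Ef) = B(w,v) =
−∫gw, so the flux at f equals ∫g(Ef − w) = ∫gu.

The hard part is that boundary values are given by `HasTrace`, a limit of smooth functions in `H1`
and in L²(∂Ω), whereas Lax–Milgram needs `H10`. The two agree: zero trace is the same as membership
in `H10` (`HasTrace.mem_H10`, `hasTrace_zero_of_mem_H10`). This gives uniqueness, the lift, and the
independence of the flux from the lift.

For the difficult inclusion no surface calculus with a normal field is used. Near a boundary point
with graph direction e, and for small τ orthogonal to e, the fundamental theorem of calculus along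
the lines parallel to e + τ gives a divergence formula whose boundary measure is dominated by
surface measure (`exists_fluxMeasure`). Hence a function of zero trace integrates by parts with no
boundary term against any smooth ψ supported near that point (`boundaryDefect_eq_zero`). Its zero
extension therefore has a weak gradient locally. Cutting off, pushing the support into Ω and
mollifying produces test functions that converge to it (`exists_mem_testClosure_mul`), and a
partition of unity assembles the pieces. -/

theorem inner_gradient_eq_fderiv (φ : Rn d → ℝ) (x b : Rn d) :
    inner ℝ b (∇ φ x) = fderiv ℝ φ x b := by
  rw [real_inner_comm, inner_gradient_left]

theorem gradient_mul_of_smooth {φ ψ : Rn d → ℝ} (hφ : ContDiff ℝ ∞ φ) (hψ : ContDiff ℝ ∞ ψ)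
    (x : Rn d) : ∇ (fun y => φ y * ψ y) x = φ x • ∇ ψ x + ψ x • ∇ φ x := by
  simp only [gradient]
  rw [fderiv_fun_mul (hφ.differentiable (by simp) x) (hψ.differentiable (by simp) x)]
  simp

theorem support_gradient_subset (φ : Rn d → ℝ) : Function.support (∇ φ) ⊆ tsupport φ := by
  intro x hx
  by_contra hn
  apply hx
  have : fderiv ℝ φ x = 0 := by
    by_contra h
    exact hn (support_fderiv_subset ℝ (f := φ) h)
  simp [gradient, this]

theorem gradient_eq_zero_of_notMem {φ : Rn d → ℝ} {x : Rn d} (hx : x ∉ tsupport φ) :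
    ∇ φ x = 0 := by
  by_contra h
  exact hx (support_gradient_subset φ h)

theorem hasCompactSupport_gradient {φ : Rn d → ℝ} (h : HasCompactSupport φ) :
    HasCompactSupport (∇ φ) :=
  (h.fderiv (𝕜 := ℝ)).comp_left (g := (InnerProductSpace.toDual ℝ (Rn d)).symm) (map_zero _)

/-- Integration by parts on the whole space. -/
theorem integral_smul_gradient {φ ψ : Rn d → ℝ} (hφ : ContDiff ℝ ∞ φ) (hψ : ContDiff ℝ ∞ ψ)
    (hc : HasCompactSupport ψ) : ∫ x, φ x • ∇ ψ x = - ∫ x, ψ x • ∇ φ x := by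
  have h1 : Integrable (fun x => φ x • ∇ ψ x) :=
    (hφ.continuous.smul (continuous_gradient_of_smooth hψ)).integrable_of_hasCompactSupport
      (hasCompactSupport_gradient hc).smul_left
  have h2 : Integrable (fun x => ψ x • ∇ φ x) :=
    (hψ.continuous.smul (continuous_gradient_of_smooth hφ)).integrable_of_hasCompactSupport
      hc.smul_right
  refine ext_inner_left ℝ (fun b => ?_)
  rw [inner_neg_right, ← integral_inner h1 b, ← integral_inner h2 b]
  simp only [inner_smul_right, inner_gradient_eq_fderiv]
  have h3 := h1.const_inner (𝕜 := ℝ) b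
  have h4 := h2.const_inner (𝕜 := ℝ) b
  simp only [inner_smul_right, inner_gradient_eq_fderiv] at h3 h4
  rw [integral_mul_fderiv_eq_neg_fderiv_mul_of_integrable (μ := volume) (f := φ) (g := ψ) (v := b)
    (by simpa only [mul_comm] using h4) h3
    ((hφ.continuous.mul hψ.continuous).integrable_of_hasCompactSupport hc.mul_left)
    (fun x _ => hφ.differentiable (by simp) x) (fun x _ => hψ.differentiable (by simp) x)]
  simp only [mul_comm]

/-- The classical gradient of a smooth function is its weak gradient. -/
theorem isWeakGradient_of_smooth {φ : Rn d → ℝ} (hφ : ContDiff ℝ ∞ φ) :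
    IsWeakGradient Ω φ (∇ φ) := by
  intro ψ hψ
  rw [setIntegral_eq_integral_of_forall_compl_eq_zero,
    setIntegral_eq_integral_of_forall_compl_eq_zero,
    integral_smul_gradient hφ hψ.smooth hψ.compact]
  · intro x hx
    rw [image_eq_zero_of_notMem_tsupport (fun h => hx (hψ.support_subset h)), zero_smul]
  · intro x hx
    rw [gradient_eq_zero_of_notMem (fun h => hx (hψ.support_subset h)), smul_zero]

theorem IsWeakGradient.congr {u u' : Rn d → ℝ} {G G' : Rn d → Rn d} (h : IsWeakGradient Ω u G)
    (hu : u' =ᵐ[volume.restrict Ω] u) (hG : G' =ᵐ[volume.restrict Ω] G) :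
    IsWeakGradient Ω u' G' := by
  intro φ hφ
  have e1 : ∫ x in Ω, u' x • ∇ φ x = ∫ x in Ω, u x • ∇ φ x :=
    integral_congr_ae (by filter_upwards [hu] with x hx; rw [hx])
  have e2 : ∫ x in Ω, φ x • G' x = ∫ x in Ω, φ x • G x :=
    integral_congr_ae (by filter_upwards [hG] with x hx; rw [hx])
  rw [e1, e2, h φ hφ]

/-- For each test function, the weak gradient identity equates two continuous functions of the pair,
since both integrals are L² pairings with a fixed factor. The space is the intersection of these
closed conditions, so `H1` is complete. -/
theorem isClosed_sobolevSpace (Ω : Set (Rn d)) :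
    IsClosed (sobolevSpace Ω : Set (WithLp 2 (L2 Ω × L2vec Ω))) := by
  let B : ℝ →L[ℝ] Rn d →L[ℝ] Rn d := ContinuousLinearMap.lsmul ℝ ℝ
  let Q : L2 Ω →L[ℝ] L2vec Ω →L[ℝ] Rn d := ContinuousLinearMap.lpPairing (volume.restrict Ω) 2 2 B
  have key : (sobolevSpace Ω : Set (WithLp 2 (L2 Ω × L2vec Ω))) =
      ⋂ (φ : Rn d → ℝ) (hφ : IsTestFunction Ω φ),
        {p | Q p.fst hφ.memLp_gradient.toLp = - Q hφ.memLp.toLp p.snd} := by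
    ext p
    simp only [mem_iInter, mem_ofPred_eq]
    refine forall₂_congr (fun φ hφ => ?_)
    have e1 : Q p.fst hφ.memLp_gradient.toLp = ∫ x in Ω, p.fst x • ∇ φ x := by
      refine (ContinuousLinearMap.lpPairing_eq_integral B _ _).trans (integral_congr_ae ?_)
      filter_upwards [hφ.memLp_gradient.coeFn_toLp] with x hx
      rw [hx]
      rfl
    have e2 : Q hφ.memLp.toLp p.snd = ∫ x in Ω, φ x • p.snd x := by
      refine (ContinuousLinearMap.lpPairing_eq_integral B _ _).trans (integral_congr_ae ?_)
      filter_upwards [hφ.memLp.coeFn_toLp] with x hx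
      rw [hx]
      rfl
    rw [e1, e2]
  rw [key]
  have c1 : Continuous (fun p : WithLp 2 (L2 Ω × L2vec Ω) => p.fst) :=
    (WithLp.fstL 2 ℝ (L2 Ω) (L2vec Ω)).continuous
  have c2 : Continuous (fun p : WithLp 2 (L2 Ω × L2vec Ω) => p.snd) :=
    (WithLp.sndL 2 ℝ (L2 Ω) (L2vec Ω)).continuous
  refine isClosed_iInter fun φ => isClosed_iInter fun hφ => isClosed_eq ?_ ?_
  · exact (Q.continuous.comp c1).clm_apply continuous_const
  · exact ((Q _).continuous.comp c2).neg

instance : CompleteSpace (H1 Ω) := (isClosed_sobolevSpace Ω).completeSpace_coe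

theorem IsTestFunction.zero : IsTestFunction Ω (0 : Rn d → ℝ) :=
  ⟨contDiff_const, HasCompactSupport.zero, by simp⟩

theorem IsTestFunction.add {φ ψ : Rn d → ℝ} (hφ : IsTestFunction Ω φ) (hψ : IsTestFunction Ω ψ) :
    IsTestFunction Ω (φ + ψ) :=
  ⟨hφ.smooth.add hψ.smooth, hφ.compact.add hψ.compact,
    (tsupport_add φ ψ).trans (union_subset hφ.support_subset hψ.support_subset)⟩

theorem IsTestFunction.smul (c : ℝ) {φ : Rn d → ℝ} (hφ : IsTestFunction Ω φ) :
    IsTestFunction Ω (c • φ) :=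
  ⟨hφ.smooth.const_smul c, hφ.compact.smul_left (f := fun _ => c),
    (tsupport_smul_subset_right (fun _ => c) φ).trans hφ.support_subset⟩

/-- The pairs `(φ, ∇φ)` of a test function and its gradient. -/
def testSubspace (Ω : Set (Rn d)) : Submodule ℝ (WithLp 2 (L2 Ω × L2vec Ω)) where
  carrier := {p | ∃ φ, IsTestFunction Ω φ ∧ p.fst =ᵐ[volume.restrict Ω] φ ∧
    p.snd =ᵐ[volume.restrict Ω] ∇ φ}
  zero_mem' := by
    refine ⟨0, .zero, Lp.coeFn_zero _ _ _, ?_⟩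
    have h0 : ∇ (0 : Rn d → ℝ) = 0 := by
      simpa using gradient_smul_of_smooth (d := d) (φ := 0) (0 : ℝ) contDiff_const
    rw [h0]
    exact Lp.coeFn_zero _ _ _
  add_mem' := by
    rintro p q ⟨φ, hφ, h1, h2⟩ ⟨ψ, hψ, k1, k2⟩
    refine ⟨φ + ψ, hφ.add hψ, ?_, ?_⟩
    · exact (Lp.coeFn_add p.fst q.fst).trans (h1.add k1)
    · rw [gradient_add_of_smooth hφ.smooth hψ.smooth]
      exact (Lp.coeFn_add p.snd q.snd).trans (h2.add k2)
  smul_mem' := by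
    rintro c p ⟨φ, hφ, h1, h2⟩
    refine ⟨c • φ, hφ.smul c, ?_, ?_⟩
    · exact (Lp.coeFn_smul c p.fst).trans (h1.const_smul c)
    · rw [gradient_smul_of_smooth c hφ.smooth]
      exact (Lp.coeFn_smul c p.snd).trans (h2.const_smul c)

/-- The closure of the test functions in the space of pairs. -/
def testClosure (Ω : Set (Rn d)) : Submodule ℝ (WithLp 2 (L2 Ω × L2vec Ω)) :=
  (testSubspace Ω).topologicalClosure

theorem testSubspace_le : testSubspace Ω ≤ sobolevSpace Ω := by
  rintro p ⟨φ, hφ, h1, h2⟩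
  exact (isWeakGradient_of_smooth hφ.smooth).congr h1 h2

/-- The pair `(φ, ∇φ)` of a test function. -/
def IsTestFunction.pair {φ : Rn d → ℝ} (hφ : IsTestFunction Ω φ) : WithLp 2 (L2 Ω × L2vec Ω) :=
  WithLp.toLp 2 (hφ.memLp.toLp, hφ.memLp_gradient.toLp)

theorem IsTestFunction.pair_mem {φ : Rn d → ℝ} (hφ : IsTestFunction Ω φ) :
    hφ.pair ∈ testSubspace Ω :=
  ⟨φ, hφ, hφ.memLp.coeFn_toLp, hφ.memLp_gradient.coeFn_toLp⟩

/-- `H¹₀(Ω)`, the closure of the test functions in `H¹(Ω)`. -/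
def H10 (Ω : Set (Rn d)) : Submodule ℝ (H1 Ω) := (testClosure Ω).comap (sobolevSpace Ω).subtype

theorem mem_H10 {u : H1 Ω} : u ∈ H10 Ω ↔ u.1 ∈ testClosure Ω := Iff.rfl

theorem isClosed_H10 : IsClosed (H10 Ω : Set (H1 Ω)) :=
  (testSubspace Ω).isClosed_topologicalClosure.preimage continuous_subtype_val

instance : CompleteSpace (H10 Ω) := isClosed_H10.completeSpace_coe

/-- A test function as an element of `H¹(Ω)`. -/
def IsTestFunction.toH1 {φ : Rn d → ℝ} (hφ : IsTestFunction Ω φ) : H1 Ω :=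
  ⟨hφ.pair, testSubspace_le hφ.pair_mem⟩

theorem IsTestFunction.toH1_mem {φ : Rn d → ℝ} (hφ : IsTestFunction Ω φ) : hφ.toH1 ∈ H10 Ω :=
  (testSubspace Ω).le_topologicalClosure hφ.pair_mem

theorem IsTestFunction.fn_toH1 {φ : Rn d → ℝ} (hφ : IsTestFunction Ω φ) :
    hφ.toH1.fn =ᵐ[volume.restrict Ω] φ := hφ.memLp.coeFn_toLp

theorem IsTestFunction.grad_toH1 {φ : Rn d → ℝ} (hφ : IsTestFunction Ω φ) :
    hφ.toH1.grad =ᵐ[volume.restrict Ω] ∇ φ := hφ.memLp_gradient.coeFn_toLp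

/-- A continuous linear functional vanishing on test functions vanishes on `H¹₀`. -/
theorem eq_zero_of_mem_H10 (ℓ : H1 Ω →L[ℝ] ℝ)
    (h : ∀ φ (hφ : IsTestFunction Ω φ), ℓ hφ.toH1 = 0) {u : H1 Ω} (hu : u ∈ H10 Ω) : ℓ u = 0 := by
  obtain ⟨p, hp, hlim⟩ := mem_closure_iff_seq_limit.1 (mem_H10.1 hu)
  let q : ℕ → H1 Ω := fun n => ⟨p n, testSubspace_le (hp n)⟩
  have hq : Tendsto q atTop (𝓝 u) := tendsto_subtype_rng.2 hlim
  have h0 : ∀ n, ℓ (q n) = 0 := by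
    intro n
    obtain ⟨φ, hφ, h1, h2⟩ := hp n
    have e : q n = hφ.toH1 := by
      apply Subtype.ext
      refine WithLp.ofLp_injective 2 (Prod.ext (Lp.ext ?_) (Lp.ext ?_))
      · exact h1.trans hφ.fn_toH1.symm
      · exact h2.trans hφ.grad_toH1.symm
    rw [e, h φ hφ]
  have := (ℓ.continuous.tendsto u).comp hq
  refine tendsto_nhds_unique this ?_
  exact tendsto_const_nhds.congr (fun n => (h0 n).symm)

theorem H1.norm_sq_eq (u : H1 Ω) : ‖u‖ ^ 2 = ‖u.1.fst‖ ^ 2 + ‖u.1.snd‖ ^ 2 :=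
  WithLp.prod_norm_sq_eq_of_L2 u.1

theorem L2.norm_sq_eq_integral {E : Type*} [NormedAddCommGroup E] [InnerProductSpace ℝ E]
    {μ : Measure (Rn d)} (u : Lp E 2 μ) : ‖u‖ ^ 2 = ∫ x, ‖u x‖ ^ 2 ∂μ := by
  rw [← real_inner_self_eq_norm_sq, L2.inner_def]
  simp only [real_inner_self_eq_norm_sq]

theorem gradient_inner_right (b x : Rn d) : ∇ (fun x : Rn d => inner ℝ b x) x = b := by
  refine ext_inner_left ℝ (fun c => ?_)
  rw [inner_gradient_eq_fderiv, real_inner_comm]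
  have : fderiv ℝ (fun x : Rn d => inner ℝ b x) x = innerSL ℝ b := (innerSL ℝ b).fderiv
  rw [this, innerSL_apply_apply]

/-- The integrand that arises when φ² is integrated by parts against the linear function b·x.
Young's inequality is weighted so that the term ½φ² can be absorbed on the left of Poincaré's
inequality. -/
theorem poincare_pointwise {R : ℝ} (hR : ∀ x ∈ Ω, ‖x‖ ≤ R) {φ : Rn d → ℝ}
    (hφ : IsTestFunction Ω φ) {b : Rn d} (hb : ‖b‖ = 1) (x : Rn d) :
    -inner ℝ b (inner ℝ b x • ∇ (fun x => φ x * φ x) x)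
      ≤ 1 / 2 * ‖φ x‖ ^ 2 + 2 * R ^ 2 * ‖∇ φ x‖ ^ 2 := by
  simp only [gradient_mul_of_smooth hφ.smooth hφ.smooth, inner_smul_right, inner_add_right]
  by_cases hx : x ∈ tsupport φ
  · have hxR := hR x (hφ.support_subset hx)
    have h1 : |inner ℝ b x| ≤ R := by
      refine (abs_real_inner_le_norm b x).trans ?_
      rwa [hb, one_mul]
    have h2 : |inner ℝ b (∇ φ x)| ≤ ‖∇ φ x‖ := by
      refine (abs_real_inner_le_norm b _).trans ?_
      rw [hb, one_mul]
    generalize inner ℝ b x = s at *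
    generalize inner ℝ b (∇ φ x) = t at *
    rw [Real.norm_eq_abs, sq_abs]
    have h3 : (s * t) ^ 2 ≤ R ^ 2 * ‖∇ φ x‖ ^ 2 := by
      rw [mul_pow, ← sq_abs s, ← sq_abs t]
      gcongr
    -- The left side is −2φst with s = b·x and t = ∂_bφ; expanding the square gives −2φst ≤ ½φ² +
    -- 2(st)².
    nlinarith [sq_nonneg (φ x + 2 * (s * t))]
  · rw [image_eq_zero_of_notMem_tsupport hx]
    simp only [zero_mul, add_zero, mul_zero, neg_zero]
    positivity

/-- Poincaré's inequality for test functions. -/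
theorem poincare_testFunction (hd : 1 ≤ d) {R : ℝ} (hR : ∀ x ∈ Ω, ‖x‖ ≤ R)
    {φ : Rn d → ℝ} (hφ : IsTestFunction Ω φ) :
    ∫ x, ‖φ x‖ ^ 2 ≤ 4 * R ^ 2 * ∫ x, ‖∇ φ x‖ ^ 2 := by
  obtain ⟨b, hb⟩ : ∃ b : Rn d, ‖b‖ = 1 := ⟨EuclideanSpace.single ⟨0, hd⟩ 1, by simp⟩
  have hψ : ContDiff ℝ ∞ (fun x => φ x * φ x) := hφ.smooth.mul hφ.smooth
  have hψc : HasCompactSupport (fun x => φ x * φ x) := hφ.compact.mul_left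
  have hlin : ContDiff ℝ ∞ (fun x : Rn d => inner ℝ b x) := (innerSL ℝ b).contDiff
  -- Since b·x has gradient b and |b| = 1, this says ∫φ² = −∫(b·x) ∂_b(φ²).
  have key := integral_smul_gradient hlin hψ hψc
  have i1 : Integrable (fun x => inner ℝ b x • ∇ (fun x => φ x * φ x) x) :=
    (hlin.continuous.smul (continuous_gradient_of_smooth hψ)).integrable_of_hasCompactSupport
      (hasCompactSupport_gradient hψc).smul_left
  simp only [gradient_inner_right] at key
  have i2 : Integrable (fun x => (φ x * φ x) • b) :=
    (hψ.continuous.smul continuous_const).integrable_of_hasCompactSupport hψc.smul_right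
  have key2 := congrArg (fun v => inner ℝ b v) key
  simp only [inner_neg_right] at key2
  rw [← integral_inner i1 b, ← integral_inner i2 b] at key2
  have j1 : Integrable (fun x => ‖φ x‖ ^ 2) :=
    (hφ.smooth.continuous.memLp_of_hasCompactSupport hφ.compact).integrable_norm_pow two_ne_zero
  have j2 : Integrable (fun x => ‖∇ φ x‖ ^ 2) :=
    ((continuous_gradient_of_smooth hφ.smooth).memLp_of_hasCompactSupport
      (hasCompactSupport_gradient hφ.compact)).integrable_norm_pow two_ne_zero
  have e2 : ∫ x, inner ℝ b ((φ x * φ x) • b) = ∫ x, ‖φ x‖ ^ 2 := by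
    refine integral_congr_ae (Eventually.of_forall fun x => ?_)
    simp only [inner_smul_right, real_inner_self_eq_norm_sq, hb, Real.norm_eq_abs, sq_abs]
    ring
  rw [e2] at key2
  have e1 : ∫ x, -inner ℝ b (inner ℝ b x • ∇ (fun x => φ x * φ x) x)
      ≤ ∫ x, (1 / 2 * ‖φ x‖ ^ 2 + 2 * R ^ 2 * ‖∇ φ x‖ ^ 2) :=
    integral_mono (i1.const_inner b).neg ((j1.const_mul _).add (j2.const_mul _))
      (poincare_pointwise hR hφ hb)
  rw [integral_neg, integral_add (j1.const_mul _) (j2.const_mul _), integral_const_mul,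
    integral_const_mul] at e1
  linarith

theorem IsTestFunction.norm_sq_pair_fst {φ : Rn d → ℝ}
    (hφ : IsTestFunction Ω φ) : ‖hφ.pair.fst‖ ^ 2 = ∫ x, ‖φ x‖ ^ 2 := by
  rw [L2.norm_sq_eq_integral, ← setIntegral_eq_integral_of_forall_compl_eq_zero (s := Ω)
    (f := fun x => ‖φ x‖ ^ 2)]
  · refine integral_congr_ae ?_
    filter_upwards [hφ.memLp.coeFn_toLp] with x hx
    rw [IsTestFunction.pair, WithLp.toLp_fst, hx]
  · intro x hx
    rw [image_eq_zero_of_notMem_tsupport (fun h => hx (hφ.support_subset h))]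
    simp

theorem IsTestFunction.norm_sq_pair_snd {φ : Rn d → ℝ}
    (hφ : IsTestFunction Ω φ) : ‖hφ.pair.snd‖ ^ 2 = ∫ x, ‖∇ φ x‖ ^ 2 := by
  rw [L2.norm_sq_eq_integral, ← setIntegral_eq_integral_of_forall_compl_eq_zero (s := Ω)
    (f := fun x => ‖∇ φ x‖ ^ 2)]
  · refine integral_congr_ae ?_
    filter_upwards [hφ.memLp_gradient.coeFn_toLp] with x hx
    rw [IsTestFunction.pair, WithLp.toLp_snd, hx]
  · intro x hx
    rw [gradient_eq_zero_of_notMem (fun h => hx (hφ.support_subset h))]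
    simp

/-- Poincaré's inequality in `H¹₀`. -/
theorem poincare_H10 (hd : 1 ≤ d) {R : ℝ} (hR : ∀ x ∈ Ω, ‖x‖ ≤ R)
    {u : H1 Ω} (hu : u ∈ H10 Ω) : ‖u.1.fst‖ ^ 2 ≤ 4 * R ^ 2 * ‖u.1.snd‖ ^ 2 := by
  have c1 : Continuous (fun p : WithLp 2 (L2 Ω × L2vec Ω) => p.fst) :=
    (WithLp.fstL 2 ℝ (L2 Ω) (L2vec Ω)).continuous
  have c2 : Continuous (fun p : WithLp 2 (L2 Ω × L2vec Ω) => p.snd) :=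
    (WithLp.sndL 2 ℝ (L2 Ω) (L2vec Ω)).continuous
  have hcl : IsClosed {p : WithLp 2 (L2 Ω × L2vec Ω) | ‖p.fst‖ ^ 2 ≤ 4 * R ^ 2 * ‖p.snd‖ ^ 2} :=
    isClosed_le (c1.norm.pow 2) (continuous_const.mul (c2.norm.pow 2))
  refine closure_minimal ?_ hcl (mem_H10.1 hu)
  rintro p ⟨φ, hφ, h1, h2⟩
  have e : p = hφ.pair :=
    WithLp.ofLp_injective 2 (Prod.ext (Lp.ext (h1.trans hφ.memLp.coeFn_toLp.symm))
      (Lp.ext (h2.trans hφ.memLp_gradient.coeFn_toLp.symm)))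
  rw [e, mem_ofPred_eq, hφ.norm_sq_pair_fst, hφ.norm_sq_pair_snd]
  exact poincare_testFunction hd hR hφ

end Basics

/-! ### The divergence theorem along oblique directions near a Lipschitz graph. -/

section Flux

variable {d : ℕ}

/-- A Lipschitz graph stays a graph over the same hyperplane when the vertical direction is tilted
slightly: `s0 z` is the height of the graph over `z` in the tilted direction. -/
theorem exists_tiltedHeight {γ : Rn d → ℝ} {K : NNReal} (hγ : LipschitzWith K γ) {τ : Rn d}
    (hτ : (K : ℝ) * ‖τ‖ ≤ 1 / 2) :
    ∃ s0 : Rn d → ℝ, Continuous s0 ∧ ∀ z s, γ (z + s • τ) < s ↔ s0 z < s := by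
  have hlip : ∀ z s z' s', |γ (z + s • τ) - γ (z' + s' • τ)| ≤ K * ‖z - z'‖ + 1 / 2 * |s - s'| := by
    intro z s z' s'
    have h1 := hγ.dist_le_mul (z + s • τ) (z' + s' • τ)
    rw [Real.dist_eq, dist_eq_norm] at h1
    have h2 : z + s • τ - (z' + s' • τ) = (z - z') + (s - s') • τ := by
      rw [sub_smul]; abel
    rw [h2] at h1
    have h3 : ‖(z - z') + (s - s') • τ‖ ≤ ‖z - z'‖ + |s - s'| * ‖τ‖ := by
      refine (norm_add_le _ _).trans ?_
      rw [norm_smul, Real.norm_eq_abs]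
    calc _ ≤ _ := h1
      _ ≤ K * (‖z - z'‖ + |s - s'| * ‖τ‖) := by gcongr
      _ = K * ‖z - z'‖ + (K * ‖τ‖) * |s - s'| := by ring
      _ ≤ _ := by gcongr
  -- The line through z meets the graph where γ(z + sτ) = s. The bound K‖τ‖ ≤ 1/2 makes this a fixed
  -- point equation for a contraction, so there is exactly one height.
  have hcon : ∀ z, ContractingWith (1 / 2) (fun s : ℝ => γ (z + s • τ)) := by
    intro z
    refine ⟨by rw [← NNReal.coe_lt_coe]; norm_num, LipschitzWith.of_dist_le_mul fun s s' => ?_⟩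
    have := hlip z s z s'
    simpa [Real.dist_eq] using this
  choose s0 hs0 using fun z => (⟨_, (hcon z).fixedPoint_isFixedPt⟩ :
    ∃ s : ℝ, γ (z + s • τ) = s)
  refine ⟨s0, ?_, fun z s => ?_⟩
  -- The factor 2 comes from absorbing the term ½|s₀z − s₀z'| on the left.
  · have : LipschitzWith (2 * K) s0 := LipschitzWith.of_dist_le_mul fun z z' => by
      have := hlip z (s0 z) z' (s0 z')
      rw [hs0, hs0] at this
      rw [Real.dist_eq, dist_eq_norm]
      push_cast
      linarith
    exact this.continuous
  · have := hlip z s z (s0 z)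
    rw [hs0, sub_self, norm_zero, mul_zero, zero_add] at this
    constructor
    · intro h
      by_contra hn
      rw [not_lt] at hn
      rw [abs_of_nonpos (sub_nonpos.2 hn)] at this
      linarith [neg_abs_le (γ (z + s • τ) - s0 z)]
    · intro h
      rw [abs_of_pos (sub_pos.2 h)] at this
      linarith [le_abs_self (γ (z + s • τ) - s0 z)]

theorem finrank_orthogonal_unit {e : Rn d} (he : ‖e‖ = 1) :
    Module.finrank ℝ ((ℝ ∙ e)ᗮ : Submodule ℝ (Rn d)) = d - 1 := by
  have h := Submodule.finrank_add_finrank_orthogonal (ℝ ∙ e)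
  rw [finrank_span_singleton (by intro h0; simp [h0] at he), finrank_euclideanSpace_fin] at h
  omega

/-- Oblique coordinates on `ℝ^d`: the hyperplane orthogonal to `e`, and a direction `e + τ`. -/
def obliqueCoord {e τ : Rn d} (he : ‖e‖ = 1) (hτ : inner ℝ e τ = 0) :
    (((ℝ ∙ e)ᗮ : Submodule ℝ (Rn d)) × ℝ) ≃L[ℝ] Rn d :=
  LinearEquiv.toContinuousLinearEquiv
  { toFun := fun p => (p.1 : Rn d) + p.2 • (e + τ)
    map_add' := fun p q => by
      simp only [Prod.fst_add, Prod.snd_add, Submodule.coe_add, add_smul]; abel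
    map_smul' := fun c p => by
      simp [mul_smul]
    invFun := fun y => (⟨y - (inner ℝ e y : ℝ) • (e + τ), by
      rw [Submodule.mem_orthogonal_singleton_iff_inner_right]
      rw [inner_sub_right, inner_smul_right, inner_add_right, hτ, real_inner_self_eq_norm_sq, he]
      ring⟩, inner ℝ e y)
    left_inv := fun p => by
      have h1 : inner ℝ e (p.1 : Rn d) = 0 :=
        (Submodule.mem_orthogonal_singleton_iff_inner_right).1 p.1.2
      have h2 : inner ℝ e ((p.1 : Rn d) + p.2 • (e + τ)) = p.2 := by
        rw [inner_add_right, inner_smul_right, inner_add_right, hτ, h1,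
          real_inner_self_eq_norm_sq, he]
        ring
      refine Prod.ext (Subtype.ext ?_) h2
      simp only [h2]
      abel
    right_inv := fun y => by simp }

theorem obliqueCoord_apply {e τ : Rn d} (he : ‖e‖ = 1) (hτ : inner ℝ e τ = 0)
    (p : ((ℝ ∙ e)ᗮ : Submodule ℝ (Rn d)) × ℝ) :
    obliqueCoord he hτ p = (p.1 : Rn d) + p.2 • (e + τ) := rfl

theorem obliqueCoord_symm_snd {e τ : Rn d} (he : ‖e‖ = 1) (hτ : inner ℝ e τ = 0) (y : Rn d) :
    ((obliqueCoord he hτ).symm y).2 = inner ℝ e y := rfl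

theorem inner_obliqueCoord {e τ : Rn d} (he : ‖e‖ = 1) (hτ : inner ℝ e τ = 0)
    (p : ((ℝ ∙ e)ᗮ : Submodule ℝ (Rn d)) × ℝ) : inner ℝ e (obliqueCoord he hτ p) = p.2 := by
  rw [← obliqueCoord_symm_snd he hτ, ContinuousLinearEquiv.symm_apply_apply]

/-- Lebesgue measure in oblique coordinates. -/
theorem exists_volume_eq_smul_map_obliqueCoord {e τ : Rn d} (he : ‖e‖ = 1)
    (hτ : inner ℝ e τ = 0) :
    ∃ κ : NNReal, (volume : Measure (Rn d)) =
      κ • ((volume : Measure (((ℝ ∙ e)ᗮ : Submodule ℝ (Rn d)) × ℝ)).map (obliqueCoord he hτ)) := by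
  have : (volume : Measure (((ℝ ∙ e)ᗮ : Submodule ℝ (Rn d)) × ℝ)).IsAddHaarMeasure := by
    rw [Measure.volume_eq_prod]; infer_instance
  have : ((volume : Measure (((ℝ ∙ e)ᗮ : Submodule ℝ (Rn d)) × ℝ)).map
      (obliqueCoord he hτ)).IsAddHaarMeasure :=
    (obliqueCoord he hτ).isAddHaarMeasure_map _
  exact ⟨_, Measure.isAddLeftInvariant_eq_smul _ _⟩

/-- Lipschitz maps onto a hyperplane push surface measure above a multiple of Lebesgue measure. -/
theorem volume_image_le {e : Rn d} (he : ‖e‖ = 1)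
    {π : Rn d → ((ℝ ∙ e)ᗮ : Submodule ℝ (Rn d))} {K : NNReal} (hπ : LipschitzWith K π)
    (S : Set (Rn d)) :
    volume (π '' S) ≤ (K : ℝ≥0∞) ^ ((d - 1 : ℕ) : ℝ) *
      Measure.euclideanHausdorffMeasure (d - 1) S := by
  rw [← InnerProductSpace.euclideanHausdorffMeasure_eq_volume, finrank_orthogonal_unit he,
    Measure.euclideanHausdorffMeasure_def, Measure.euclideanHausdorffMeasure_def]
  simp only [Measure.coe_nnreal_smul_apply]
  rw [mul_left_comm]
  gcongr
  exact hπ.hausdorffMeasure_image_le (by positivity) S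

/-- The divergence theorem in one direction `e + τ` near a piece of Lipschitz boundary, with a
boundary measure which is dominated by surface measure. -/
theorem exists_fluxMeasure {Ω U : Set (Rn d)} {e τ : Rn d} {K : NNReal} {γ : Rn d → ℝ}
    (hΩ : IsOpen Ω) (hU : IsOpen U) (he : ‖e‖ = 1) (hγ : LipschitzWith K γ)
    (hΩU : Ω ∩ U = {y ∈ U | γ (y - inner ℝ e y • e) < inner ℝ e y})
    (hτ : inner ℝ e τ = 0) (hK : (K : ℝ) * ‖τ‖ ≤ 1 / 2) :
    ∃ (ν : Measure (Rn d)) (C : ℝ≥0∞), IsFiniteMeasureOnCompacts ν ∧ C ≠ ⊤ ∧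
      ν.restrict U ≤ C • surfaceMeasure Ω ∧
      ∀ Φ : Rn d → ℝ, ContDiff ℝ ∞ Φ → HasCompactSupport Φ → tsupport Φ ⊆ U →
        ∫ x in Ω, inner ℝ (e + τ) (∇ Φ x) = - ∫ x, Φ x ∂ν := by
  obtain ⟨s0, hs0c, hs0lt⟩ := exists_tiltedHeight hγ hK
  obtain ⟨κ, hκ⟩ := exists_volume_eq_smul_map_obliqueCoord he hτ
  set F : Submodule ℝ (Rn d) := (ℝ ∙ e)ᗮ with hF
  let L := obliqueCoord he hτ
  let g : F → Rn d := fun z => L (z, s0 z)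
  have hgc : Continuous g := L.continuous.comp (by fun_prop)
  -- The projection along e + τ inverts the graph map `g` and is Lipschitz. The boundary measure
  -- below is κ times the image of Lebesgue measure under `g`, and π compares it with Hausdorff
  -- measure.
  let π : Rn d → F := fun y => (L.symm y).1
  have hπg : ∀ z, π (g z) = z := fun z => by simp [π, g]
  have hπl : LipschitzWith ‖(ContinuousLinearMap.fst ℝ F ℝ).comp (L.symm : Rn d →L[ℝ] F × ℝ)‖₊ π :=
    ((ContinuousLinearMap.fst ℝ F ℝ).comp (L.symm : Rn d →L[ℝ] F × ℝ)).lipschitz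
  have hsub : ∀ p : F × ℝ, L p - (inner ℝ e (L p) : ℝ) • e = p.1 + p.2 • τ := by
    intro p
    rw [inner_obliqueCoord, obliqueCoord_apply, smul_add]
    abel
  have hE : ∀ p : F × ℝ, γ (L p - (inner ℝ e (L p) : ℝ) • e) < inner ℝ e (L p) ↔ s0 p.1 < p.2 := by
    intro p
    rw [hsub, inner_obliqueCoord]
    exact hs0lt _ _
  -- A graph point in U is a limit of points of Ω lying above it, but is not in Ω itself because the
  -- epigraph is strict.
  have hfr : ∀ z, g z ∈ U → g z ∈ frontier Ω := by
    intro z hz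
    have hmem : ∀ s, L (z, s) ∈ U → (L (z, s) ∈ Ω ↔ s0 z < s) := by
      intro s hs
      have h1 : L (z, s) ∈ Ω ∩ U ↔ L (z, s) ∈ {y ∈ U | γ (y - inner ℝ e y • e) < inner ℝ e y} := by
        rw [hΩU]
      have h2 := hE (z, s)
      constructor
      · intro h
        exact h2.1 (h1.1 ⟨h, hs⟩).2
      · intro h
        exact (h1.2 ⟨hs, h2.2 h⟩).1
    rw [hΩ.frontier_eq]
    refine ⟨?_, fun h => lt_irrefl _ ((hmem _ hz).1 h)⟩
    have hc : Continuous (fun s : ℝ => L (z, s)) := L.continuous.comp (by fun_prop)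
    have h1 : Tendsto (fun s : ℝ => L (z, s)) (𝓝[>] (s0 z)) (𝓝 (g z)) :=
      (hc.tendsto _).mono_left nhdsWithin_le_nhds
    refine mem_closure_of_tendsto h1 ?_
    filter_upwards [h1.eventually (hU.mem_nhds hz), self_mem_nhdsWithin] with s hs hs'
    exact (hmem s hs).2 hs'
  have hmap : ∀ {A : Set (Rn d)}, MeasurableSet A →
      (κ • (volume : Measure F).map g) A = κ * volume (g ⁻¹' A) := by
    intro A hA
    rw [Measure.coe_nnreal_smul_apply, Measure.map_apply hgc.measurable hA]
  refine ⟨κ • (volume : Measure F).map g, κ * (‖(ContinuousLinearMap.fst ℝ F ℝ).comp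
    (L.symm : Rn d →L[ℝ] F × ℝ)‖₊ : ℝ≥0∞) ^ ((d - 1 : ℕ) : ℝ), ⟨fun A hA => ?_⟩, ?_, ?_, ?_⟩
  · rw [hmap hA.measurableSet]
    refine ENNReal.mul_lt_top ENNReal.coe_lt_top ?_
    have hc : IsCompact (π '' A) := hA.image hπl.continuous
    refine (measure_mono ?_).trans_lt hc.measure_lt_top
    intro z hz
    exact ⟨g z, hz, hπg z⟩
  · exact ENNReal.mul_ne_top ENNReal.coe_ne_top
      (ENNReal.rpow_ne_top_of_nonneg (Nat.cast_nonneg _) ENNReal.coe_ne_top)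
  · refine Measure.le_iff.2 (fun A hA => ?_)
    rw [Measure.restrict_apply hA, hmap (hA.inter hU.measurableSet), Measure.smul_apply,
      surfaceMeasure, Measure.restrict_apply hA, smul_eq_mul, mul_assoc]
    gcongr
    -- The parameters z with `g z` in A ∩ U lie in π(A ∩ ∂Ω), whose volume is controlled by the
    -- Lipschitz bound for π.
    refine (measure_mono ?_).trans (volume_image_le he hπl (A ∩ frontier Ω))
    rintro z ⟨hzA, hzU⟩
    exact ⟨g z, ⟨hzA, hfr z hzU⟩, hπg z⟩
  · intro Φ hΦ hΦc hΦU
    let E : Set (F × ℝ) := {p | s0 p.1 < p.2}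
    have hEm : MeasurableSet E :=
      measurableSet_lt (by fun_prop) measurable_snd
    have hcd : Continuous (fun p : F × ℝ => (inner ℝ (e + τ) (∇ Φ (L p)) : ℝ)) :=
      continuous_const.inner ((continuous_gradient_of_smooth hΦ).comp L.continuous)
    have hcs : HasCompactSupport (fun p : F × ℝ => (inner ℝ (e + τ) (∇ Φ (L p)) : ℝ)) :=
      ((hasCompactSupport_gradient hΦc).comp_homeomorph L.toHomeomorph).comp_left
        (g := fun w => (inner ℝ (e + τ) w : ℝ)) (inner_zero_right _)
    have hint : Integrable (E.indicator fun p : F × ℝ => (inner ℝ (e + τ) (∇ Φ (L p)) : ℝ)) :=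
      (hcd.integrable_of_hasCompactSupport hcs).indicator hEm
    have e1 : ∫ x in Ω, inner ℝ (e + τ) (∇ Φ x)
        = κ • ∫ p, E.indicator (fun p : F × ℝ => (inner ℝ (e + τ) (∇ Φ (L p)) : ℝ)) p := by
      rw [← integral_indicator hΩ.measurableSet]
      conv_lhs => rw [hκ]
      rw [integral_smul_nnreal_measure]
      congr 1
      have hme : MeasurableEmbedding (obliqueCoord he hτ) :=
        (obliqueCoord he hτ).toHomeomorph.measurableEmbedding
      rw [hme.integral_map]
      refine integral_congr_ae (Eventually.of_forall fun p => ?_)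
      change Ω.indicator _ (L p) = _
      -- Inside U, Ω is the epigraph of `s0`; outside U the gradient of Φ vanishes. So Ω may be
      -- replaced by the whole epigraph.
      by_cases hp : L p ∈ U
      · have h1 : L p ∈ Ω ∩ U ↔ L p ∈ {y ∈ U | γ (y - inner ℝ e y • e) < inner ℝ e y} := by
          rw [hΩU]
        have h2 : L p ∈ Ω ↔ p ∈ E :=
          ⟨fun h => (hE p).1 (h1.1 ⟨h, hp⟩).2, fun h => (h1.2 ⟨hp, (hE p).2 h⟩).1⟩
        by_cases hp' : p ∈ E
        · rw [indicator_of_mem hp', indicator_of_mem (h2.2 hp')]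
        · rw [indicator_of_notMem hp', indicator_of_notMem (fun h => hp' (h2.1 h))]
      · have h0 : ∇ Φ (L p) = 0 := gradient_eq_zero_of_notMem (fun h => hp (hΦU h))
        rw [indicator_apply_eq_zero.2 fun _ => by simp [h0],
          indicator_apply_eq_zero.2 fun _ => by simp [h0]]
    have e2 : ∀ z : F, ∫ s, E.indicator (fun p : F × ℝ => (inner ℝ (e + τ) (∇ Φ (L p)) : ℝ)) (z, s)
        = - Φ (g z) := by
      intro z
      have haff : ContDiff ℝ ∞ (fun s : ℝ => L (z, s)) :=
        L.contDiff.comp (contDiff_const.prodMk contDiff_id)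
      have hcdz : ContDiff ℝ 1 (fun s : ℝ => Φ (L (z, s))) := (hΦ.comp haff).of_le (by simp)
      have hcsz : HasCompactSupport (fun s : ℝ => Φ (L (z, s))) := by
        refine hΦc.comp_isClosedEmbedding (g := fun s : ℝ => L (z, s)) ?_
        exact L.toHomeomorph.isClosedEmbedding.comp
          ⟨isEmbedding_prodMkRight z, by
            have : range (Prod.mk z : ℝ → F × ℝ) = Prod.fst ⁻¹' {z} := by
              ext ⟨a, b⟩; simp [eq_comm]
            rw [this]
            exact isClosed_singleton.preimage continuous_fst⟩
      have hder : ∀ s, deriv (fun s : ℝ => Φ (L (z, s))) s = inner ℝ (e + τ) (∇ Φ (L (z, s))) := by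
        intro s
        have h1 : HasDerivAt (fun s : ℝ => L (z, s)) (e + τ) s := by
          have : HasDerivAt (fun s : ℝ => (z : Rn d) + s • (e + τ)) ((1 : ℝ) • (e + τ)) s :=
            ((hasDerivAt_id s).smul_const (e + τ)).const_add _
          rwa [one_smul] at this
        have h2 := (hΦ.differentiable (by simp) (L (z, s))).hasFDerivAt.comp_hasDerivAt s h1
        rw [inner_gradient_eq_fderiv]
        exact h2.deriv
      -- Compact support removes the contribution at infinity, so only the value on the graph
      -- remains.
      have h3 := hcsz.integral_Ioi_deriv_eq hcdz (s0 z)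
      simp only [hder] at h3
      rw [← integral_indicator measurableSet_Ioi] at h3
      rw [← h3]
      rfl
    rw [e1, Measure.volume_eq_prod, integral_prod _ hint]
    simp only [e2]
    rw [integral_neg, integral_smul_nnreal_measure, integral_map hgc.measurable.aemeasurable
      hΦ.continuous.aestronglyMeasurable, smul_neg]

end Flux

/-! ### Zero trace implies integration by parts without a boundary term, locally. -/

section ZeroTrace

variable {d : ℕ}

theorem tendsto_integral_smul_left {E : Type*} [NormedAddCommGroup E] [NormedSpace ℝ E]
    [CompleteSpace E] {μ : Measure (Rn d)} {f : ℕ → Rn d → ℝ} {u : Rn d → ℝ} {g : Rn d → E}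
    (hf : ∀ n, AEStronglyMeasurable (f n) μ) (hu : MemLp u 2 μ) (hg : MemLp g 2 μ)
    (h : Tendsto (fun n => eLpNorm (f n - u) 2 μ) atTop (𝓝 0)) :
    Tendsto (fun n => ∫ x, f n x • g x ∂μ) atTop (𝓝 (∫ x, u x • g x ∂μ)) := by
  have hmem : ∀ᶠ n in atTop, MemLp (f n - u) 2 μ := by
    filter_upwards [h.eventually (gt_mem_nhds ENNReal.zero_lt_top)] with n hn
    exact ⟨(hf n).sub hu.1, hn⟩
  refine tendsto_integral_of_L1' _ (hu.1.smul hg.1) ?_ ?_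
  · filter_upwards [hmem] with n hn
    have : MemLp (f n) 2 μ := by simpa using hn.add hu
    exact memLp_one_iff_integrable.1 (hg.smul this)
  · have h2 := ENNReal.Tendsto.mul_const (b := eLpNorm g 2 μ) h (Or.inr hg.2.ne)
    rw [zero_mul] at h2
    refine tendsto_of_tendsto_of_tendsto_of_le_of_le tendsto_const_nhds h2 (fun _ => zero_le)
      (fun n => ?_)
    have e : (fun x => f n x • g x) - (fun x => u x • g x) = (f n - u) • g := by
      ext x; simp [sub_smul]
    change eLpNorm ((fun x => f n x • g x) - (fun x => u x • g x)) 1 μ ≤ _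
    rw [e]
    exact eLpNorm_smul_le_mul_eLpNorm hg.1 ((hf n).sub hu.1)

theorem tendsto_integral_smul_right {E : Type*} [NormedAddCommGroup E] [NormedSpace ℝ E]
    [CompleteSpace E] {μ : Measure (Rn d)} {f : ℕ → Rn d → E} {u : Rn d → E} {g : Rn d → ℝ}
    (hf : ∀ n, AEStronglyMeasurable (f n) μ) (hu : MemLp u 2 μ) (hg : MemLp g 2 μ)
    (h : Tendsto (fun n => eLpNorm (f n - u) 2 μ) atTop (𝓝 0)) :
    Tendsto (fun n => ∫ x, g x • f n x ∂μ) atTop (𝓝 (∫ x, g x • u x ∂μ)) := by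
  have hmem : ∀ᶠ n in atTop, MemLp (f n - u) 2 μ := by
    filter_upwards [h.eventually (gt_mem_nhds ENNReal.zero_lt_top)] with n hn
    exact ⟨(hf n).sub hu.1, hn⟩
  refine tendsto_integral_of_L1' _ (hg.1.smul hu.1) ?_ ?_
  · filter_upwards [hmem] with n hn
    have : MemLp (f n) 2 μ := by simpa using hn.add hu
    exact memLp_one_iff_integrable.1 (this.smul hg)
  · have h2 := ENNReal.Tendsto.const_mul (a := eLpNorm g 2 μ) h (Or.inr hg.2.ne)
    rw [mul_zero] at h2
    refine tendsto_of_tendsto_of_tendsto_of_le_of_le tendsto_const_nhds h2 (fun _ => zero_le)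
      (fun n => ?_)
    have e : (fun x => g x • f n x) - (fun x => g x • u x) = g • (f n - u) := by
      ext x; simp [smul_sub]
    change eLpNorm ((fun x => g x • f n x) - (fun x => g x • u x)) 1 μ ≤ _
    rw [e]
    exact eLpNorm_smul_le_mul_eLpNorm ((hf n).sub hu.1) hg.1

theorem H1.memLp_fn {Ω : Set (Rn d)} (u : H1 Ω) : MemLp u.fn 2 (volume.restrict Ω) := Lp.memLp _

theorem H1.memLp_grad {Ω : Set (Rn d)} (u : H1 Ω) : MemLp u.grad 2 (volume.restrict Ω) :=
  Lp.memLp _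

/-- The defect in the integration by parts of `u ∈ H¹(Ω)` against `ψ`. -/
def boundaryDefect {Ω : Set (Rn d)} (u : H1 Ω) (ψ : Rn d → ℝ) : Rn d :=
  (∫ x in Ω, u.fn x • ∇ ψ x) + ∫ x in Ω, ψ x • u.grad x

/-- For the smooth approximants φₙ, the v-component of the defect is −∫φₙψ dν by the product rule
and the flux formula. It tends to the component for w by L² convergence in Ω, and to 0 because φₙ →
0 in L² of surface measure, which dominates ν on U up to a constant. -/
theorem inner_boundaryDefect_eq_zero {Ω U : Set (Rn d)} {w : H1 Ω} (hw : HasTrace w 0)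
    {v : Rn d} {ν : Measure (Rn d)} [IsFiniteMeasureOnCompacts ν] {C : ℝ≥0∞} (hC : C ≠ ⊤)
    (hν : ν.restrict U ≤ C • surfaceMeasure Ω)
    (hflux : ∀ Φ : Rn d → ℝ, ContDiff ℝ ∞ Φ → HasCompactSupport Φ → tsupport Φ ⊆ U →
        ∫ x in Ω, inner ℝ v (∇ Φ x) = - ∫ x, Φ x ∂ν)
    {ψ : Rn d → ℝ} (hψ : ContDiff ℝ ∞ ψ) (hψc : HasCompactSupport ψ) (hψU : tsupport ψ ⊆ U) :
    inner ℝ v (boundaryDefect w ψ) = 0 := by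
  obtain ⟨φ, hφ, h1, h2, h3⟩ := hw
  have mψ : MemLp ψ 2 (volume.restrict Ω) :=
    (hψ.continuous.memLp_of_hasCompactSupport hψc).restrict Ω
  have mψ' : MemLp (∇ ψ) 2 (volume.restrict Ω) :=
    ((continuous_gradient_of_smooth hψ).memLp_of_hasCompactSupport
      (hasCompactSupport_gradient hψc)).restrict Ω
  have t1 := (tendsto_integral_smul_left (fun n => (hφ n).continuous.aestronglyMeasurable)
    w.memLp_fn mψ' h1).add (tendsto_integral_smul_right
    (fun n => (continuous_gradient_of_smooth (hφ n)).aestronglyMeasurable) w.memLp_grad mψ h2)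
  have t2 := (tendsto_const_nhds (x := v)).inner (𝕜 := ℝ) t1
  have e : ∀ n, inner ℝ v ((∫ x in Ω, φ n x • ∇ ψ x) + ∫ x in Ω, ψ x • ∇ (φ n) x)
      = - ∫ x in U, φ n x • ψ x ∂ν := by
    intro n
    have i1 : Integrable (fun x => φ n x • ∇ ψ x) (volume.restrict Ω) :=
      (((hφ n).continuous.smul (continuous_gradient_of_smooth hψ)).integrable_of_hasCompactSupport
        (hasCompactSupport_gradient hψc).smul_left).restrict
    have i2 : Integrable (fun x => ψ x • ∇ (φ n) x) (volume.restrict Ω) :=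
      ((hψ.continuous.smul (continuous_gradient_of_smooth (hφ n))).integrable_of_hasCompactSupport
        hψc.smul_right).restrict
    have i3 : Integrable (fun x => φ n x • ∇ ψ x + ψ x • ∇ (φ n) x) (volume.restrict Ω) := i1.add i2
    rw [← integral_add i1 i2, ← integral_inner i3 v,
      setIntegral_eq_integral_of_forall_compl_eq_zero (s := U)]
    · simp only [smul_eq_mul]
      rw [← hflux (fun x => φ n x * ψ x) ((hφ n).mul hψ) hψc.mul_left
        ((tsupport_mul_subset_right).trans hψU)]
      refine integral_congr_ae (Eventually.of_forall fun x => ?_)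
      simp only [gradient_mul_of_smooth (hφ n) hψ]
    · intro x hx
      rw [image_eq_zero_of_notMem_tsupport (fun h => hx (hψU h)), smul_zero]
  have h4 : Tendsto (fun n => eLpNorm (φ n - 0) 2 (ν.restrict U)) atTop (𝓝 0) := by
    have h5 := ENNReal.Tendsto.const_mul (a := C ^ (1 / (2 : ℝ≥0∞)).toReal) h3
      (Or.inr (ENNReal.rpow_ne_top_of_nonneg ENNReal.toReal_nonneg hC))
    rw [mul_zero] at h5
    refine tendsto_of_tendsto_of_tendsto_of_le_of_le tendsto_const_nhds h5 (fun _ => zero_le)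
      (fun n => ?_)
    change eLpNorm (φ n - 0) 2 (ν.restrict U) ≤ _
    have e1 : φ n - ((0 : L2bdry Ω) : Rn d → ℝ) =ᵐ[surfaceMeasure Ω] φ n - 0 := by
      filter_upwards [Lp.coeFn_zero ℝ 2 (surfaceMeasure Ω)] with x hx
      simp only [Pi.sub_apply, hx]
    rw [eLpNorm_congr_ae e1, ← smul_eq_mul]
    refine (eLpNorm_mono_measure _ hν).trans ?_
    rw [eLpNorm_smul_measure_of_ne_top (by norm_num)]
  have t3 := (tendsto_integral_smul_left
    (fun n => (hφ n).continuous.aestronglyMeasurable) (MemLp.zero (ε := ℝ))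
    ((hψ.continuous.memLp_of_hasCompactSupport (μ := ν) (p := 2) hψc).restrict U) h4).neg
  simp only [Pi.zero_apply, zero_smul, integral_zero, neg_zero] at t3
  refine tendsto_nhds_unique t2 (t3.congr fun n => (e n).symm)

/-- Near a Lipschitz boundary point, integration by parts holds for functions with zero trace
without a boundary term. -/
theorem boundaryDefect_eq_zero {Ω U : Set (Rn d)} {e : Rn d} {K : NNReal} {γ : Rn d → ℝ}
    (hΩ : IsOpen Ω) (hU : IsOpen U) (he : ‖e‖ = 1) (hγ : LipschitzWith K γ)
    (hΩU : Ω ∩ U = {y ∈ U | γ (y - inner ℝ e y • e) < inner ℝ e y})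
    {w : H1 Ω} (hw : HasTrace w 0)
    {ψ : Rn d → ℝ} (hψ : ContDiff ℝ ∞ ψ) (hψc : HasCompactSupport ψ) (hψU : tsupport ψ ⊆ U) :
    boundaryDefect w ψ = 0 := by
  have key : ∀ τ : Rn d, inner ℝ e τ = 0 → (K : ℝ) * ‖τ‖ ≤ 1 / 2 →
      inner ℝ (e + τ) (boundaryDefect w ψ) = 0 := by
    intro τ h1 h2
    obtain ⟨ν, C, hν, hC, hle, hflux⟩ := exists_fluxMeasure hΩ hU he hγ hΩU h1 h2
    exact inner_boundaryDefect_eq_zero hw hC hle hflux hψ hψc hψU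
  set J := boundaryDefect w ψ
  -- With τ = 0 the defect J is orthogonal to e, so a multiple of J is itself an admissible tilt
  -- once scaled to satisfy K‖τ‖ ≤ 1/2; that tilt forces ‖J‖² = 0.
  have h0 : inner ℝ e J = 0 := by simpa using key 0 (by simp) (by simp)
  have hpos : (0 : ℝ) < 2 * (K * ‖J‖ + 1) := by positivity
  have h1 := key ((2 * (K * ‖J‖ + 1))⁻¹ • J) (by rw [inner_smul_right, h0, mul_zero]) (by
    rw [norm_smul, norm_inv, Real.norm_of_nonneg hpos.le]
    rw [mul_left_comm, inv_mul_le_iff₀ hpos]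
    linarith [norm_nonneg J])
  rw [inner_add_left, h0, zero_add, inner_smul_left, real_inner_self_eq_norm_sq] at h1
  have h2 : ‖J‖ ^ 2 = 0 := by
    refine (mul_eq_zero.1 h1).resolve_left ?_
    simpa using hpos.ne'
  simpa using h2

end ZeroTrace

/-! ### L² convergence of mollifications with off-centre kernels. -/

section Mollify

variable {d : ℕ} {E : Type*} [NormedAddCommGroup E]

/-- Translations are continuous in `L²`. -/
theorem tendsto_eLpNorm_translate_sub {f : Rn d → E} (hf : MemLp f 2 volume) :
    Tendsto (fun t => eLpNorm (fun x => f (x - t) - f x) 2 volume) (𝓝 (0 : Rn d)) (𝓝 0) := by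
  let g : Rn d → C(Rn d, Rn d) := fun t => ⟨fun x => x - t, by fun_prop⟩
  have hg : Continuous g :=
    ContinuousMap.continuous_of_continuous_uncurry _ (by
      change Continuous (fun p : Rn d × Rn d => p.2 - p.1)
      fun_prop)
  have hgm : ∀ t, MeasurePreserving (g t) volume volume := fun t =>
    measurePreserving_sub_right volume t
  have h := (continuous_const (y := hf.toLp f)).compMeasurePreservingLp hg hgm (by norm_num)
  have h2 := (Lp.tendsto_Lp_iff_tendsto_eLpNorm' _ _).1 (h.tendsto 0)
  refine h2.congr (fun t => eLpNorm_congr_ae ?_)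
  have e : ∀ t, (Lp.compMeasurePreserving (g t) (hgm t) (hf.toLp f) : Rn d → E) =ᵐ[volume]
      fun x => f (x - t) := fun t =>
    (Lp.coeFn_compMeasurePreserving _ _).trans
      ((hgm t).quasiMeasurePreserving.ae_eq_comp hf.coeFn_toLp)
  filter_upwards [e t, e 0] with x h1 h2
  rw [Pi.sub_apply, h1, h2, sub_zero]

theorem sq_lintegral_le_lintegral_sq {μ : Measure (Rn d)} [IsProbabilityMeasure μ]
    {h : Rn d → ℝ≥0∞} (hh : AEMeasurable h μ) :
    (∫⁻ t, h t ∂μ) ^ 2 ≤ ∫⁻ t, h t ^ 2 ∂μ := by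
  have h1 := ENNReal.lintegral_mul_le_Lp_mul_Lq μ Real.HolderConjugate.two_two hh
    (aemeasurable_const (b := (1 : ℝ≥0∞)))
  simp only [Pi.mul_apply, mul_one, ENNReal.one_rpow, lintegral_const, measure_univ] at h1
  calc (∫⁻ t, h t ∂μ) ^ 2 ≤ ((∫⁻ t, h t ^ (2 : ℝ) ∂μ) ^ (1 / (2 : ℝ))) ^ 2 := by gcongr
    _ = ∫⁻ t, h t ^ 2 ∂μ := by
      rw [← ENNReal.rpow_natCast, ← ENNReal.rpow_mul]
      simp

theorem eLpNorm_two_sq {μ : Measure (Rn d)} (f : Rn d → E) :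
    eLpNorm f 2 μ ^ 2 = ∫⁻ x, ‖f x‖ₑ ^ 2 ∂μ := by
  have := eLpNorm_nnreal_pow_eq_lintegral (μ := μ) (f := f) (p := 2) (by norm_num)
  simpa using this

variable [NormedSpace ℝ E] [CompleteSpace E]

/-- An average of translates is as close to `f` in `L²` as the translates are. -/
theorem eLpNorm_convolution_sub_le {f : Rn d → E} (hf : MemLp f 2 volume)
    (hfm : StronglyMeasurable f) {ρ : Rn d → ℝ} (hρ : Continuous ρ) (hρc : HasCompactSupport ρ)
    (hρ0 : ∀ x, 0 ≤ ρ x) (hρ1 : ∫ x, ρ x = 1) {ε : ℝ≥0∞}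
    (hε : ∀ t ∈ Function.support ρ, eLpNorm (fun x => f (x - t) - f x) 2 volume ≤ ε) :
    eLpNorm (convolution ρ f (ContinuousLinearMap.lsmul ℝ ℝ) volume - f) 2 volume ≤ ε := by
  -- Under this probability measure, ρ∗f − f is the mean of the translation differences of f.
  -- Jensen's inequality for the square and then Tonelli bound its L² norm by theirs.
  let μ : Measure (Rn d) := volume.withDensity (fun t => ENNReal.ofReal (ρ t))
  have hρm : Measurable (fun t => ENNReal.ofReal (ρ t)) := hρ.measurable.ennreal_ofReal
  have hρi : Integrable ρ := hρ.integrable_of_hasCompactSupport hρc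
  have : IsProbabilityMeasure μ := ⟨by
    rw [withDensity_apply _ MeasurableSet.univ, Measure.restrict_univ,
      ← ofReal_integral_eq_lintegral_ofReal hρi (Eventually.of_forall hρ0), hρ1, ENNReal.ofReal_one]⟩
  have hm2 : StronglyMeasurable (fun p : Rn d × Rn d => f (p.1 - p.2) - f p.1) :=
    (hfm.comp_measurable (measurable_fst.sub measurable_snd)).sub
      (hfm.comp_measurable measurable_fst)
  have hm2' : Measurable (fun p : Rn d × Rn d => ‖f (p.1 - p.2) - f p.1‖ₑ) := hm2.enorm
  have hloc : LocallyIntegrable f volume := hf.locallyIntegrable (by norm_num)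
  have hpt : ∀ x, ‖(convolution ρ f (ContinuousLinearMap.lsmul ℝ ℝ) volume - f) x‖ₑ ^ 2
      ≤ ∫⁻ t, ‖f (x - t) - f x‖ₑ ^ 2 ∂μ := by
    intro x
    have i1 : Integrable (fun t => ρ t • f (x - t)) :=
      hρc.convolutionExists_left (L := ContinuousLinearMap.lsmul ℝ ℝ) hρ hloc x
    have e1 : (convolution ρ f (ContinuousLinearMap.lsmul ℝ ℝ) volume - f) x
        = ∫ t, ρ t • (f (x - t) - f x) := by
      simp only [smul_sub]
      rw [Pi.sub_apply, convolution_lsmul, integral_sub i1 (hρi.smul_const _),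
        integral_smul_const, hρ1, one_smul]
    have e2 : ‖∫ t, ρ t • (f (x - t) - f x)‖ₑ ≤ ∫⁻ t, ‖f (x - t) - f x‖ₑ ∂μ := by
      refine (enorm_integral_le_lintegral_enorm _).trans (le_of_eq ?_)
      have hx : Measurable (fun t => ‖f (x - t) - f x‖ₑ) :=
        hm2'.comp (measurable_const.prodMk measurable_id)
      rw [lintegral_withDensity_eq_lintegral_mul _ hρm hx]
      refine lintegral_congr (fun t => ?_)
      rw [enorm_smul, Pi.mul_apply, Real.enorm_eq_ofReal (hρ0 t)]
    rw [e1]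
    calc _ ≤ (∫⁻ t, ‖f (x - t) - f x‖ₑ ∂μ) ^ 2 := by gcongr
      _ ≤ _ := sq_lintegral_le_lintegral_sq
        (hm2'.comp (measurable_const.prodMk measurable_id)).aemeasurable
  have hsq : eLpNorm (convolution ρ f (ContinuousLinearMap.lsmul ℝ ℝ) volume - f) 2 volume ^ 2
      ≤ ε ^ 2 := by
    rw [eLpNorm_two_sq]
    calc _ ≤ ∫⁻ x, (∫⁻ t, ‖f (x - t) - f x‖ₑ ^ 2 ∂μ) := lintegral_mono hpt
      _ = ∫⁻ t, (∫⁻ x, ‖f (x - t) - f x‖ₑ ^ 2) ∂μ :=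
        lintegral_lintegral_swap (hm2'.pow_const 2).aemeasurable
      _ ≤ ∫⁻ _, ε ^ 2 ∂μ := by
        refine lintegral_mono_ae ?_
        have : ∀ᵐ t ∂μ, t ∈ Function.support ρ := by
          rw [ae_withDensity_iff hρm]
          refine Eventually.of_forall fun t ht => ?_
          intro h0
          simp [h0] at ht
        filter_upwards [this] with t ht
        rw [← eLpNorm_two_sq]
        gcongr
        exact hε t ht
      _ = ε ^ 2 := by simp
  exact (ENNReal.pow_le_pow_left_iff two_ne_zero).1 hsq

/-- Mollifications with kernels concentrating at the origin, centred anywhere, converge in `L²`. -/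
theorem tendsto_eLpNorm_convolution_sub {f : Rn d → E} (hf : MemLp f 2 volume)
    (hfm : StronglyMeasurable f) {c : ℕ → Rn d} (b : ∀ n, ContDiffBump (c n))
    (hc : Tendsto (fun n => ‖c n‖ + (b n).rOut) atTop (𝓝 0)) :
    Tendsto (fun n => eLpNorm (convolution ((b n).normed volume) f
      (ContinuousLinearMap.lsmul ℝ ℝ) volume - f) 2 volume) atTop (𝓝 0) := by
  rw [ENNReal.tendsto_nhds_zero]
  intro ε hε
  obtain ⟨r, hr, hball⟩ := Metric.eventually_nhds_iff.1
    ((ENNReal.tendsto_nhds_zero.1 (tendsto_eLpNorm_translate_sub hf)) ε hε)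
  filter_upwards [hc.eventually (gt_mem_nhds hr)] with n hn
  refine eLpNorm_convolution_sub_le hf hfm (b n).continuous_normed (b n).hasCompactSupport_normed
    (b n).nonneg_normed (b n).integral_normed (fun t ht => hball ?_)
  rw [(b n).support_normed_eq, mem_ball_iff_norm] at ht
  rw [dist_zero_right]
  calc ‖t‖ = ‖c n + (t - c n)‖ := by congr 1; abel
    _ ≤ ‖c n‖ + ‖t - c n‖ := norm_add_le _ _
    _ < r := by linarith

end Mollify

/-! ### Cutting off and mollifying the zero extension. -/

section Localize

open scoped Pointwise

variable {d : ℕ} {Ω : Set (Rn d)}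

theorem memLp_mul_fn (u : H1 Ω) {η : Rn d → ℝ} (hη : Continuous η) (hηc : HasCompactSupport η) :
    MemLp (fun x => η x * u.fn x) 2 (volume.restrict Ω) :=
  u.memLp_fn.smul (p := ⊤) (r := 2) ((hη.memLp_of_hasCompactSupport hηc).restrict Ω)

theorem memLp_mul_grad (u : H1 Ω) {η : Rn d → ℝ} (hη : ContDiff ℝ ∞ η)
    (hηc : HasCompactSupport η) :
    MemLp (fun x => η x • u.grad x + u.fn x • ∇ η x) 2 (volume.restrict Ω) := by
  refine MemLp.add ?_ ?_
  · exact u.memLp_grad.smul (p := ⊤) (r := 2)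
      ((hη.continuous.memLp_of_hasCompactSupport hηc).restrict Ω)
  · exact MemLp.smul (p := 2) (q := ⊤) (r := 2)
      (((continuous_gradient_of_smooth hη).memLp_of_hasCompactSupport
        (hasCompactSupport_gradient hηc)).restrict Ω) u.memLp_fn

theorem stronglyMeasurable_fn (u : H1 Ω) : StronglyMeasurable u.fn := Lp.stronglyMeasurable _

theorem stronglyMeasurable_grad (u : H1 Ω) : StronglyMeasurable u.grad := Lp.stronglyMeasurable _

theorem gradient_comp_const_sub {ρ : Rn d → ℝ} (hρ : ContDiff ℝ ∞ ρ) (x y : Rn d) :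
    ∇ (fun y => ρ (x - y)) y = - ∇ ρ (x - y) := by
  refine ext_inner_left ℝ (fun b => ?_)
  rw [inner_neg_right, inner_gradient_eq_fderiv, inner_gradient_eq_fderiv]
  have h := ((hρ.differentiable (by simp) (x - y)).hasFDerivAt.comp y
    ((hasFDerivAt_id y).const_sub x)).fderiv
  change fderiv ℝ (ρ ∘ HSub.hSub x) y b = _
  rw [h]
  simp

/-- The mollification of the zero extension of `η u`, and its gradient, when `u` has no boundary
defect on the support of `η`. -/
theorem gradient_convolution_indicator (hΩ : IsOpen Ω) (u : H1 Ω) {η ρ : Rn d → ℝ}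
    (hη : ContDiff ℝ ∞ η) (hηc : HasCompactSupport η) (hρ : ContDiff ℝ ∞ ρ)
    (hρc : HasCompactSupport ρ)
    (hdef : ∀ ψ : Rn d → ℝ, ContDiff ℝ ∞ ψ → HasCompactSupport ψ → tsupport ψ ⊆ tsupport η →
      boundaryDefect u ψ = 0) (x : Rn d) :
    ∇ (convolution ρ (Ω.indicator fun x => η x * u.fn x) (ContinuousLinearMap.lsmul ℝ ℝ) volume) x
      = convolution ρ (Ω.indicator fun x => η x • u.grad x + u.fn x • ∇ η x)
        (ContinuousLinearMap.lsmul ℝ ℝ) volume x := by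
  have hρx : ContDiff ℝ ∞ (fun y => ρ (x - y)) := hρ.comp (contDiff_const.sub contDiff_id)
  have hρxc : HasCompactSupport (fun y => ρ (x - y)) :=
    hρc.comp_homeomorph (Homeomorph.subLeft x)
  have mgρ : MemLp (fun y => ∇ ρ (x - y)) 2 (volume.restrict Ω) :=
    (((continuous_gradient_of_smooth hρ).comp (continuous_const.sub
      continuous_id)).memLp_of_hasCompactSupport
        ((hasCompactSupport_gradient hρc).comp_homeomorph (Homeomorph.subLeft x))).restrict Ω
  have mρη : MemLp (fun y => ρ (x - y) • ∇ η y) 2 (volume.restrict Ω) :=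
    ((hρx.continuous.smul (continuous_gradient_of_smooth hη)).memLp_of_hasCompactSupport
      hρxc.smul_right).restrict Ω
  have mψ : MemLp (fun y => ρ (x - y) * η y) 2 (volume.restrict Ω) :=
    ((hρx.continuous.mul hη.continuous).memLp_of_hasCompactSupport hηc.mul_left).restrict Ω
  have mηu := memLp_mul_fn u hη.continuous hηc
  have i1 : Integrable (fun y => (η y * u.fn y) • ∇ ρ (x - y)) (volume.restrict Ω) :=
    integrable_smul_of_memLp mηu mgρ
  have i2 : Integrable (fun y => u.fn y • (ρ (x - y) • ∇ η y)) (volume.restrict Ω) :=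
    integrable_smul_of_memLp u.memLp_fn mρη
  have i3 : Integrable (fun y => (ρ (x - y) * η y) • u.grad y) (volume.restrict Ω) :=
    integrable_smul_of_memLp mψ u.memLp_grad
  -- The vanishing defect is applied to ψ(y) = ρ(x − y)η(y), whose support lies in that of η. The
  -- minus sign in ∇_y ρ(x − y) puts the two sides in the form of convolutions.
  have key : ∫ y in Ω, (η y * u.fn y) • ∇ ρ (x - y)
      = ∫ y in Ω, ρ (x - y) • (η y • u.grad y + u.fn y • ∇ η y) := by
    have h := hdef (fun y => ρ (x - y) * η y) (hρx.mul hη) hηc.mul_left tsupport_mul_subset_right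
    have e1 : ∫ y in Ω, u.fn y • ∇ (fun y => ρ (x - y) * η y) y
        = (∫ y in Ω, u.fn y • (ρ (x - y) • ∇ η y)) - ∫ y in Ω, (η y * u.fn y) • ∇ ρ (x - y) := by
      rw [← integral_sub i2 i1]
      refine integral_congr_ae (Eventually.of_forall fun y => ?_)
      simp only [gradient_mul_of_smooth hρx hη, gradient_comp_const_sub hρ]
      module
    rw [boundaryDefect, e1] at h
    have e2 : ∫ y in Ω, ρ (x - y) • (η y • u.grad y + u.fn y • ∇ η y)
        = (∫ y in Ω, (ρ (x - y) * η y) • u.grad y) + ∫ y in Ω, u.fn y • (ρ (x - y) • ∇ η y) := by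
      rw [← integral_add i3 i2]
      refine integral_congr_ae (Eventually.of_forall fun y => ?_)
      module
    rw [e2]
    have h' := sub_eq_zero.1 ((by abel : (∫ y in Ω, u.fn y • (ρ (x - y) • ∇ η y))
      + (∫ y in Ω, (ρ (x - y) * η y) • u.grad y) - (∫ y in Ω, (η y * u.fn y) • ∇ ρ (x - y))
      = (∫ y in Ω, u.fn y • (ρ (x - y) • ∇ η y)) - (∫ y in Ω, (η y * u.fn y) • ∇ ρ (x - y))
      + ∫ y in Ω, (ρ (x - y) * η y) • u.grad y).trans h)
    rw [← h', add_comm]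
  have hloc : LocallyIntegrable (Ω.indicator fun x => η x * u.fn x) volume :=
    ((memLp_indicator_iff_restrict hΩ.measurableSet).2 mηu).locallyIntegrable (by norm_num)
  have hfd := hρc.hasFDerivAt_convolution_left (ContinuousLinearMap.lsmul ℝ ℝ)
    (hρ.of_le (by simp)) hloc x
  have hint := ((hρc.fderiv (𝕜 := ℝ)).convolutionExists_left
    (L := (ContinuousLinearMap.lsmul ℝ ℝ : ℝ →L[ℝ] ℝ →L[ℝ] ℝ).precompL (Rn d))
    (hρ.continuous_fderiv (by simp)) hloc x).integrable_swap
  refine ext_inner_left ℝ (fun b => ?_)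
  rw [inner_gradient_eq_fderiv, hfd.fderiv, convolution_eq_swap, convolution_lsmul_swap,
    ContinuousLinearMap.integral_apply hint]
  have e3 : ∫ t, ρ (x - t) • Ω.indicator (fun x => η x • u.grad x + u.fn x • ∇ η x) t
      = ∫ y in Ω, ρ (x - y) • (η y • u.grad y + u.fn y • ∇ η y) := by
    rw [← integral_indicator hΩ.measurableSet]
    refine integral_congr_ae (Eventually.of_forall fun y => ?_)
    by_cases hy : y ∈ Ω
    · simp only [indicator_of_mem hy]
    · simp only [indicator_of_notMem hy, smul_zero]
  rw [e3, ← key, ← integral_inner i1 b, ← integral_indicator hΩ.measurableSet]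
  refine integral_congr_ae (Eventually.of_forall fun y => ?_)
  by_cases hy : y ∈ Ω
  · simp only [indicator_of_mem hy, ContinuousLinearMap.precompL_apply, inner_smul_right,
      inner_gradient_eq_fderiv, ContinuousLinearMap.lsmul_apply, smul_eq_mul]
    ring
  · simp only [indicator_of_notMem hy, map_zero, zero_apply]

/-- If `u` has no boundary defect on the support of `η` and that support can be pushed into `Ω`,
then `η u` is a limit of test functions. -/
theorem exists_mem_testClosure_mul (hΩ : IsOpen Ω) (u : H1 Ω) {η : Rn d → ℝ}
    (hη : ContDiff ℝ ∞ η) (hηc : HasCompactSupport η)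
    (hdef : ∀ ψ : Rn d → ℝ, ContDiff ℝ ∞ ψ → HasCompactSupport ψ → tsupport ψ ⊆ tsupport η →
      boundaryDefect u ψ = 0)
    {c : ℕ → Rn d} (b : ∀ n, ContDiffBump (c n))
    (hc : Tendsto (fun n => ‖c n‖ + (b n).rOut) atTop (𝓝 0))
    (hpush : ∀ n, ∀ p ∈ tsupport η ∩ closure Ω, ∀ y ∈ Metric.closedBall (c n) (b n).rOut,
      y + p ∈ Ω) :
    ∃ p ∈ testClosure Ω, p.fst =ᵐ[volume.restrict Ω] (fun x => η x * u.fn x) ∧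
      p.snd =ᵐ[volume.restrict Ω] fun x => η x • u.grad x + u.fn x • ∇ η x := by
  set W := Ω.indicator fun x => η x * u.fn x with hW
  set G := Ω.indicator fun x => η x • u.grad x + u.fn x • ∇ η x with hG
  have mW : MemLp W 2 volume :=
    (memLp_indicator_iff_restrict hΩ.measurableSet).2 (memLp_mul_fn u hη.continuous hηc)
  have mG : MemLp G 2 volume :=
    (memLp_indicator_iff_restrict hΩ.measurableSet).2 (memLp_mul_grad u hη hηc)
  have sW : StronglyMeasurable W :=
    (hη.continuous.stronglyMeasurable.mul (stronglyMeasurable_fn u)).indicator hΩ.measurableSet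
  have sG : StronglyMeasurable G :=
    ((hη.continuous.stronglyMeasurable.smul (stronglyMeasurable_grad u)).add
      ((stronglyMeasurable_fn u).smul
        (continuous_gradient_of_smooth hη).stronglyMeasurable)).indicator hΩ.measurableSet
  let θ : ℕ → Rn d → ℝ := fun n =>
    convolution ((b n).normed volume) W (ContinuousLinearMap.lsmul ℝ ℝ) volume
  have hθt : ∀ n, IsTestFunction Ω (θ n) := by
    intro n
    -- The mollification is supported in this compact sumset, which `hpush` places inside Ω; hence
    -- it is a genuine test function.
    have hK : IsCompact (Metric.closedBall (c n) (b n).rOut + tsupport η ∩ closure Ω) :=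
      (isCompact_closedBall _ _).add (hηc.isCompact.inter_right isClosed_closure)
    have hsub : Function.support (θ n) ⊆
        Metric.closedBall (c n) (b n).rOut + tsupport η ∩ closure Ω := by
      refine (support_convolution_subset _).trans (add_subset_add ?_ ?_)
      · rw [(b n).support_normed_eq]
        exact Metric.ball_subset_closedBall
      · intro y hy
        have hyΩ : y ∈ Ω := by
          by_contra h
          exact hy (indicator_of_notMem h _)
        refine ⟨?_, subset_closure hyΩ⟩
        by_contra h
        apply hy
        rw [hW, indicator_of_mem hyΩ, image_eq_zero_of_notMem_tsupport h, zero_mul]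
    refine ⟨?_, HasCompactSupport.of_support_subset_isCompact hK hsub,
      (closure_minimal hsub hK.isClosed).trans ?_⟩
    · exact (b n).hasCompactSupport_normed.contDiff_convolution_left _ (b n).contDiff_normed
        (mW.locallyIntegrable (by norm_num))
    · rintro _ ⟨y, hy, p, hp, rfl⟩
      exact hpush n p hp y hy
  have hgrad : ∀ n, ∇ (θ n) =
      convolution ((b n).normed volume) G (ContinuousLinearMap.lsmul ℝ ℝ) volume := fun n =>
    funext fun x => gradient_convolution_indicator hΩ u hη hηc (b n).contDiff_normed
      (b n).hasCompactSupport_normed hdef x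
  have t1 : Tendsto (fun n => eLpNorm (θ n - W) 2 (volume.restrict Ω)) atTop (𝓝 0) :=
    tendsto_of_tendsto_of_tendsto_of_le_of_le tendsto_const_nhds
      (tendsto_eLpNorm_convolution_sub mW sW b hc) (fun _ => zero_le)
      (fun n => eLpNorm_mono_measure _ Measure.restrict_le_self)
  have t2 : Tendsto (fun n => eLpNorm (∇ (θ n) - G) 2 (volume.restrict Ω)) atTop (𝓝 0) := by
    simp only [hgrad]
    exact tendsto_of_tendsto_of_tendsto_of_le_of_le tendsto_const_nhds
      (tendsto_eLpNorm_convolution_sub mG sG b hc) (fun _ => zero_le)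
      (fun n => eLpNorm_mono_measure _ Measure.restrict_le_self)
  have k1 := (Lp.tendsto_Lp_iff_tendsto_eLpNorm'' _ (fun n => (hθt n).memLp) W (mW.restrict Ω)).2 t1
  have k2 := (Lp.tendsto_Lp_iff_tendsto_eLpNorm'' _ (fun n => (hθt n).memLp_gradient) G
    (mG.restrict Ω)).2 t2
  refine ⟨WithLp.toLp 2 ((mW.restrict Ω).toLp W, (mG.restrict Ω).toLp G), ?_, ?_, ?_⟩
  · refine mem_closure_of_tendsto (((WithLp.prod_continuous_toLp 2 _ _).tendsto _).comp
      (k1.prodMk_nhds k2)) (Eventually.of_forall fun n => ?_)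
    exact (hθt n).pair_mem
  · exact (mW.restrict Ω).coeFn_toLp.trans (indicator_ae_eq_restrict hΩ.measurableSet)
  · exact (mG.restrict Ω).coeFn_toLp.trans (indicator_ae_eq_restrict hΩ.measurableSet)

end Localize

/-! ### Functions of zero trace are exactly `H10`. -/

section ZeroTraceSpace

variable {d : ℕ} {Ω : Set (Rn d)}

theorem tendsto_const_div_nat_add_one (δ : ℝ) :
    Tendsto (fun n : ℕ => δ / ((n : ℝ) + 1)) atTop (𝓝 0) := by
  have := (tendsto_one_div_add_atTop_nhds_zero_nat (𝕜 := ℝ)).const_mul δ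
  simpa [div_eq_mul_inv] using this

/-- A finite smooth partition of unity on a compact set. -/
theorem exists_finite_partition {K : Set (Rn d)} (hK : IsCompact K) (N : K → Set (Rn d))
    (hN : ∀ x, IsOpen (N x)) (hx : ∀ x : K, (x : Rn d) ∈ N x) :
    ∃ (T : Finset K) (η : K → Rn d → ℝ), (∀ i, ContDiff ℝ ∞ (η i)) ∧
      (∀ i, HasCompactSupport (η i)) ∧ (∀ i, tsupport (η i) ⊆ N i) ∧
      ∀ x ∈ K, ∑ i ∈ T, η i x = 1 := by
  obtain ⟨f, hf⟩ := SmoothPartitionOfUnity.exists_isSubordinate (modelWithCornersSelf ℝ (Rn d))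
    -- Intersecting with unit balls makes every member of the partition compactly supported.
    hK.isClosed (fun x : K => N x ∩ Metric.ball (x : Rn d) 1)
    (fun x => (hN x).inter Metric.isOpen_ball)
    (fun x hxK => mem_iUnion.2 ⟨⟨x, hxK⟩, hx ⟨x, hxK⟩, Metric.mem_ball_self one_pos⟩)
  have hfin := f.locallyFinite.finite_nonempty_inter_compact hK
  refine ⟨hfin.toFinset, fun i => f i, fun i => (f i).contMDiff.contDiff, fun i => ?_,
    fun i => (hf i).trans inter_subset_left, fun x hxK => ?_⟩
  · refine (isCompact_closedBall (i : Rn d) 1).of_isClosed_subset (isClosed_tsupport _) ?_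
    exact ((hf i).trans inter_subset_right).trans Metric.ball_subset_closedBall
  · rw [← f.sum_eq_one hxK]
    refine (finsum_eq_sum_of_support_subset _ fun i hi => ?_).symm
    rw [Finite.coe_toFinset]
    exact ⟨x, hi, hxK⟩

theorem norm_sub_inner_smul_le {e : Rn d} (he : ‖e‖ = 1) (z : Rn d) :
    ‖z - (inner ℝ e z : ℝ) • e‖ ≤ ‖z‖ := by
  refine le_of_sq_le_sq ?_ (norm_nonneg z)
  rw [norm_sub_sq_real, inner_smul_right, norm_smul, he, real_inner_comm, mul_one, Real.norm_eq_abs,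
    sq_abs]
  nlinarith [sq_nonneg (inner ℝ e z : ℝ)]

/-- Near each point of `closure Ω` a function with zero trace can be cut off to a limit of test
functions. -/
theorem exists_open_forall_mul_mem (hΩ : IsOpen Ω) (hΩL : HasLipschitzBoundary Ω) {w : H1 Ω}
    (hw : HasTrace w 0) (x : Rn d) (hx : x ∈ closure Ω) :
    ∃ N : Set (Rn d), IsOpen N ∧ x ∈ N ∧ ∀ η : Rn d → ℝ, ContDiff ℝ ∞ η → HasCompactSupport η →
      tsupport η ⊆ N → ∃ p ∈ testClosure Ω, p.fst =ᵐ[volume.restrict Ω] (fun x => η x * w.fn x) ∧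
        p.snd =ᵐ[volume.restrict Ω] fun x => η x • w.grad x + w.fn x • ∇ η x := by
  by_cases hxΩ : x ∈ Ω
  · refine ⟨Ω, hΩ, hxΩ, fun η hη hηc hηΩ => ?_⟩
    obtain ⟨δ, hδ, hthick⟩ := hηc.isCompact.exists_cthickening_subset_open hΩ hηΩ
    have hpos : ∀ n : ℕ, 0 < δ / (n + 1) := fun n => by positivity
    refine exists_mem_testClosure_mul hΩ w hη hηc (fun ψ h1 h2 h3 => ?_) (c := fun _ => 0)
      (fun n => ⟨δ / (n + 1) / 2, δ / (n + 1), half_pos (hpos n), half_lt_self (hpos n)⟩) ?_ ?_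
    · rw [boundaryDefect, add_eq_zero_iff_eq_neg]
      -- Away from the boundary, the vanishing of the defect is the definition of the weak gradient.
      exact w.2 ψ ⟨h1, h2, h3.trans hηΩ⟩
    · simp only [norm_zero, zero_add]
      exact tendsto_const_div_nat_add_one δ
    · intro n p hp y hy
      refine hthick (Metric.mem_cthickening_of_dist_le _ p _ _ hp.1 ?_)
      rw [mem_closedBall_zero_iff] at hy
      rw [dist_eq_norm, add_sub_cancel_right]
      refine hy.trans (div_le_self hδ.le ?_)
      linarith [(Nat.cast_nonneg n : (0 : ℝ) ≤ n)]
  · have hxf : x ∈ frontier Ω := by rw [hΩ.frontier_eq]; exact ⟨hx, hxΩ⟩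
    obtain ⟨U, e, K, γ, hU, hxU, he, hγ, hΩU⟩ := hΩL x hxf
    refine ⟨U, hU, hxU, fun η hη hηc hηU => ?_⟩
    obtain ⟨δ, hδ, hthick⟩ := hηc.isCompact.exists_cthickening_subset_open hU hηU
    let t : ℕ → ℝ := fun n => δ / 2 / (n + 1)
    have ht : ∀ n, 0 < t n := fun n => by positivity
    have htδ : ∀ n, t n ≤ δ / 2 := fun n => by
      refine div_le_self (by positivity) ?_
      linarith [(Nat.cast_nonneg n : (0 : ℝ) ≤ n)]
    have ht0 : Tendsto t atTop (𝓝 0) := tendsto_const_div_nat_add_one (δ / 2)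
    -- The kernels are centred at t e with radius κt. A shift y in this ball raises the e-component
    -- by at least (1 − κ)t, while the graph rises by at most Kκt, so (K + 1)κ < 1 carries points of
    -- the closure strictly inside the epigraph. The choice t ≤ δ/2, with κ ≤ 1, keeps the shifted
    -- support in U.
    let κ : ℝ := 1 / (K + 2)
    have hK0 : (0 : ℝ) ≤ K := K.2
    have hκ : 0 < κ := by positivity
    have hκ1 : κ ≤ 1 := by
      rw [div_le_one (by positivity)]; linarith
    have hκK : (K + 1) * κ < 1 := by
      rw [mul_one_div, div_lt_one (by positivity)]; linarith
    have hpos : ∀ n, 0 < κ * t n := fun n => mul_pos hκ (ht n)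
    refine exists_mem_testClosure_mul hΩ w hη hηc (fun ψ h1 h2 h3 => ?_) (c := fun n => t n • e)
      (fun n => ⟨κ * t n / 2, κ * t n, half_pos (hpos n), half_lt_self (hpos n)⟩) ?_ ?_
    · exact boundaryDefect_eq_zero hΩ hU he hγ hΩU hw h1 h2 (h3.trans hηU)
    · have : Tendsto (fun n => |t n| + κ * t n) atTop (𝓝 (|0| + κ * 0)) :=
        ht0.abs.add (ht0.const_mul κ)
      simpa [norm_smul, he] using this
    · intro n p hp y hy
      change y ∈ Metric.closedBall (t n • e) (κ * t n) at hy
      rw [mem_closedBall_iff_norm] at hy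
      have hpU : p ∈ U := hηU hp.1
      -- On the closure of Ω only the non-strict inequality survives; the shift restores strictness.
      have hpe : γ (p - (inner ℝ e p : ℝ) • e) ≤ inner ℝ e p := by
        have hcl : IsClosed {y : Rn d | γ (y - (inner ℝ e y : ℝ) • e) ≤ inner ℝ e y} :=
          isClosed_le (hγ.continuous.comp (by fun_prop)) (by fun_prop)
        have hmem : p ∈ closure (Ω ∩ U) := by
          rw [inter_comm]
          exact hU.inter_closure ⟨hpU, hp.2⟩
        refine closure_minimal ?_ hcl hmem
        rw [hΩU]
        exact fun y hy => le_of_lt hy.2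
      have hyn : ‖y‖ ≤ δ := by
        calc ‖y‖ = ‖(y - t n • e) + t n • e‖ := by rw [sub_add_cancel]
          _ ≤ κ * t n + t n := by
            refine (norm_add_le _ _).trans (add_le_add hy ?_)
            rw [norm_smul, he, mul_one, Real.norm_of_nonneg (ht n).le]
          _ ≤ 1 * t n + t n := by gcongr
          _ ≤ δ := by linarith [htδ n]
      have hU' : y + p ∈ U := by
        refine hthick (Metric.mem_cthickening_of_dist_le _ p _ _ hp.1 ?_)
        rwa [dist_eq_norm, add_sub_cancel_right]
      have hee : inner ℝ e e = (1 : ℝ) := by rw [real_inner_self_eq_norm_sq, he, one_pow]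
      have h1 : t n - κ * t n ≤ inner ℝ e y := by
        have h0 : |inner ℝ e (y - t n • e)| ≤ κ * t n :=
          (abs_real_inner_le_norm e (y - t n • e)).trans (by rwa [he, one_mul])
        have h2 := (abs_le.1 h0).1
        rw [inner_sub_right, inner_smul_right, hee] at h2
        linarith
      have h3 : ‖y - (inner ℝ e y : ℝ) • e‖ ≤ κ * t n := by
        refine le_trans (le_of_eq ?_) ((norm_sub_inner_smul_le he (y - t n • e)).trans hy)
        rw [inner_sub_right, inner_smul_right, hee]
        congr 1
        module
      have h4 : γ (y + p - (inner ℝ e (y + p) : ℝ) • e)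
          ≤ γ (p - (inner ℝ e p : ℝ) • e) + K * (κ * t n) := by
        have h5 := (le_abs_self _).trans (hγ.dist_le_mul (y + p - (inner ℝ e (y + p) : ℝ) • e)
          (p - (inner ℝ e p : ℝ) • e))
        rw [dist_eq_norm] at h5
        have h6 : y + p - (inner ℝ e (y + p) : ℝ) • e - (p - (inner ℝ e p : ℝ) • e)
            = y - (inner ℝ e y : ℝ) • e := by
          rw [inner_add_right]; module
        rw [h6] at h5
        have h7 : (K : ℝ) * ‖y - (inner ℝ e y : ℝ) • e‖ ≤ K * (κ * t n) := by gcongr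
        linarith
      have hfin : y + p ∈ Ω ∩ U := by
        rw [hΩU]
        refine ⟨hU', ?_⟩
        rw [inner_add_right] at h4 ⊢
        have := mul_lt_mul_of_pos_right hκK (ht n)
        linarith
      exact hfin.1

theorem sum_gradient_eq_zero {ι : Type*} {T : Finset ι} {η : ι → Rn d → ℝ}
    (hη : ∀ i, ContDiff ℝ ∞ (η i)) (hΩ : IsOpen Ω) (h : ∀ x ∈ Ω, ∑ i ∈ T, η i x = 1)
    {x : Rn d} (hx : x ∈ Ω) : ∑ i ∈ T, ∇ (η i) x = 0 := by
  refine ext_inner_left ℝ (fun b => ?_)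
  rw [inner_sum, inner_zero_right]
  simp only [inner_gradient_eq_fderiv]
  have h1 : fderiv ℝ (fun y => ∑ i ∈ T, η i y) x = 0 := by
    have : (fun y => ∑ i ∈ T, η i y) =ᶠ[𝓝 x] fun _ => 1 := by
      filter_upwards [hΩ.mem_nhds hx] with y hy using h y hy
    rw [this.fderiv_eq, fderiv_fun_const]
    rfl
  rw [fderiv_fun_sum fun i _ => (hη i).differentiable (by simp) x] at h1
  have h2 := congrArg (fun L : Rn d →L[ℝ] ℝ => L b) h1
  simpa using h2

/-- A function in `H¹(Ω)` with zero trace belongs to `H¹₀(Ω)`. -/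
theorem HasTrace.mem_H10 (hΩ : IsOpen Ω) (hΩb : Bornology.IsBounded Ω)
    (hΩL : HasLipschitzBoundary Ω) {w : H1 Ω} (hw : HasTrace w 0) : w ∈ H10 Ω := by
  choose N hNo hxN hN using exists_open_forall_mul_mem hΩ hΩL hw
  obtain ⟨T, η, hη, hηc, hηN, hsum⟩ := exists_finite_partition hΩb.isCompact_closure
    (fun x => N x x.2) (fun x => hNo x x.2) (fun x => hxN x x.2)
  choose p hp hp1 hp2 using fun i : closure Ω => hN i i.2 (η i) (hη i) (hηc i) (hηN i)
  rw [AdjointMap.mem_H10]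
  -- The cut-offs sum to 1 on Ω, so the pieces sum to w and the extra gradient terms w∇ηᵢ cancel.
  have e : w.1 = ∑ i ∈ T, p i := by
    have f1 : (∑ i ∈ T, p i).fst = ∑ i ∈ T, (p i).fst :=
      map_sum (WithLp.fstL 2 ℝ (L2 Ω) (L2vec Ω)) p T
    have f2 : (∑ i ∈ T, p i).snd = ∑ i ∈ T, (p i).snd :=
      map_sum (WithLp.sndL 2 ℝ (L2 Ω) (L2vec Ω)) p T
    refine WithLp.ofLp_injective 2 (Prod.ext ?_ ?_)
    · change w.1.fst = (∑ i ∈ T, p i).fst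
      rw [f1]
      refine Lp.ext ?_
      filter_upwards [Lp.coeFn_finsetSum T fun i => (p i).fst,
        (T.eventually_all).2 fun i _ => hp1 i, ae_restrict_mem hΩ.measurableSet] with x h1 h2 hx
      rw [h1, Finset.sum_apply, Finset.sum_congr rfl h2, ← Finset.sum_mul,
        hsum x (subset_closure hx), one_mul]
      rfl
    · change w.1.snd = (∑ i ∈ T, p i).snd
      rw [f2]
      refine Lp.ext ?_
      filter_upwards [Lp.coeFn_finsetSum T fun i => (p i).snd,
        (T.eventually_all).2 fun i _ => hp2 i, ae_restrict_mem hΩ.measurableSet] with x h1 h2 hx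
      rw [h1, Finset.sum_apply, Finset.sum_congr rfl h2, Finset.sum_add_distrib, ← Finset.sum_smul,
        ← Finset.smul_sum, hsum x (subset_closure hx), one_smul,
        sum_gradient_eq_zero hη hΩ (fun y hy => hsum y (subset_closure hy)) hx, smul_zero, add_zero]
      rfl
  rw [e]
  exact (testClosure Ω).sum_mem fun i _ => hp i

/-- Functions in `H¹₀(Ω)` have zero trace. -/
theorem hasTrace_zero_of_mem_H10 (hΩ : IsOpen Ω) {w : H1 Ω} (hw : w ∈ H10 Ω) :
    HasTrace w 0 := by
  obtain ⟨p, hp, hlim⟩ := mem_closure_iff_seq_limit.1 (AdjointMap.mem_H10.1 hw)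
  choose φ hφ h1 h2 using hp
  have l1 : Tendsto (fun n => (p n).fst) atTop (𝓝 w.1.fst) :=
    ((WithLp.fstL 2 ℝ (L2 Ω) (L2vec Ω)).continuous.tendsto _).comp hlim
  have l2 : Tendsto (fun n => (p n).snd) atTop (𝓝 w.1.snd) :=
    ((WithLp.sndL 2 ℝ (L2 Ω) (L2vec Ω)).continuous.tendsto _).comp hlim
  refine ⟨φ, fun n => (hφ n).smooth, ?_, ?_, ?_⟩
  · exact ((Lp.tendsto_Lp_iff_tendsto_eLpNorm' _ _).1 l1).congr fun n =>
      eLpNorm_congr_ae ((h1 n).sub .rfl)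
  · exact ((Lp.tendsto_Lp_iff_tendsto_eLpNorm' _ _).1 l2).congr fun n =>
      eLpNorm_congr_ae ((h2 n).sub .rfl)
  · refine tendsto_const_nhds.congr fun n => ?_
    symm
    rw [eLpNorm_congr_ae (g := 0), eLpNorm_zero]
    -- Test functions vanish on ∂Ω because Ω is open, so the boundary norms are identically zero.
    have hm : ∀ᵐ x ∂(surfaceMeasure Ω), x ∈ frontier Ω :=
      ae_restrict_mem isClosed_frontier.measurableSet
    filter_upwards [hm, Lp.coeFn_zero ℝ 2 (surfaceMeasure Ω)] with x hx h0
    rw [hΩ.frontier_eq] at hx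
    rw [Pi.sub_apply, h0, image_eq_zero_of_notMem_tsupport fun h => hx.2 ((hφ n).support_subset h)]
    simp

end ZeroTraceSpace

/-! ### The energy form, Lax–Milgram, restriction, and lifting of traces. -/

section Dirichlet

variable {d : ℕ} {Ω Ω' : Set (Rn d)}

/-- The continuous linear map `u ↦ u` from `H¹(Ω)` to `L²(Ω)`. -/
def fnL (Ω : Set (Rn d)) : H1 Ω →L[ℝ] L2 Ω :=
  (WithLp.fstL 2 ℝ (L2 Ω) (L2vec Ω)).comp (sobolevSpace Ω).subtypeL

/-- The continuous linear map `u ↦ ∇u` from `H¹(Ω)` to `L²(Ω)^d`. -/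
def gradL (Ω : Set (Rn d)) : H1 Ω →L[ℝ] L2vec Ω :=
  (WithLp.sndL 2 ℝ (L2 Ω) (L2vec Ω)).comp (sobolevSpace Ω).subtypeL

theorem memLp_coeff_smul_grad {a : Rn d → ℝ} (ha : MemLp a ⊤ (volume.restrict Ω)) (u : H1 Ω) :
    MemLp (fun x => a x • u.grad x) 2 (volume.restrict Ω) :=
  u.memLp_grad.smul (p := ⊤) (r := 2) ha

theorem integrable_inner_of_memLp {F G : Rn d → Rn d} (hF : MemLp F 2 (volume.restrict Ω))
    (hG : MemLp G 2 (volume.restrict Ω)) :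
    Integrable (fun x => (inner ℝ (F x) (G x) : ℝ)) (volume.restrict Ω) := by
  refine (L2.integrable_inner (𝕜 := ℝ) hF.toLp hG.toLp).congr ?_
  filter_upwards [hF.coeFn_toLp, hG.coeFn_toLp] with x h1 h2
  rw [h1, h2]

/-- The bilinear form `(u, v) ↦ ∫_Ω a ∇u · ∇v` on `H¹(Ω)`. -/
theorem exists_energyForm {a : Rn d → ℝ} (ha : MemLp a ⊤ (volume.restrict Ω)) :
    ∃ B : H1 Ω →L[ℝ] H1 Ω →L[ℝ] ℝ, ∀ u v : H1 Ω,
      B u v = ∫ x in Ω, inner ℝ (a x • u.grad x) (v.grad x) := by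
  let A : L2vec Ω →L[ℝ] L2vec Ω :=
    (ContinuousLinearMap.lsmul ℝ ℝ).holderL (volume.restrict Ω) ⊤ 2 2 ha.toLp
  refine ⟨(innerSL ℝ).bilinearComp (A.comp (gradL Ω)) (gradL Ω), fun u v => ?_⟩
  change inner ℝ (A (gradL Ω u)) (gradL Ω v) = _
  rw [L2.inner_def]
  refine integral_congr_ae ?_
  filter_upwards [ha.coeFn_toLp, ContinuousLinearMap.coeFn_holder (r := 2)
    (ContinuousLinearMap.lsmul ℝ ℝ) ha.toLp (gradL Ω u)] with x h1 h2
  change inner ℝ ((A (gradL Ω u) : Rn d → Rn d) x) _ = _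
  rw [show (A (gradL Ω u) : Rn d → Rn d) x = a x • u.grad x by
    rw [← h1]; exact h2]
  rfl

theorem energyForm_symm {a : Rn d → ℝ} {B : H1 Ω →L[ℝ] H1 Ω →L[ℝ] ℝ}
    (hB : ∀ u v : H1 Ω, B u v = ∫ x in Ω, inner ℝ (a x • u.grad x) (v.grad x)) (u v : H1 Ω) :
    B u v = B v u := by
  rw [hB, hB]
  refine integral_congr_ae (Eventually.of_forall fun x => ?_)
  simp only [inner_smul_left, real_inner_comm]

/-- The form `∫_Ω a ∇u · ∇v` is coercive on `H¹₀(Ω)`. -/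
theorem energyForm_coercive (hd : 1 ≤ d) (hΩb : Bornology.IsBounded Ω)
    {a : Rn d → ℝ} (ha : MemLp a ⊤ (volume.restrict Ω)) {α : ℝ} (hα : 0 < α)
    (haα : ∀ᵐ x ∂(volume.restrict Ω), α ≤ a x) {B : H1 Ω →L[ℝ] H1 Ω →L[ℝ] ℝ}
    (hB : ∀ u v : H1 Ω, B u v = ∫ x in Ω, inner ℝ (a x • u.grad x) (v.grad x)) :
    ∃ c : ℝ, 0 < c ∧ ∀ u ∈ H10 Ω, c * ‖u‖ * ‖u‖ ≤ B u u := by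
  obtain ⟨R, hR⟩ := hΩb.exists_norm_le
  -- Poincaré's inequality gives ‖u‖² ≤ (4R² + 1)‖∇u‖², and a ≥ α bounds the energy below by α‖∇u‖².
  refine ⟨α / (4 * R ^ 2 + 1), by positivity, fun u hu => ?_⟩
  have h1 := poincare_H10 hd hR hu
  have h2 := H1.norm_sq_eq u
  have h3 : α * ‖u.1.snd‖ ^ 2 ≤ B u u := by
    rw [hB, L2.norm_sq_eq_integral, ← integral_const_mul]
    refine integral_mono_ae ((u.memLp_grad.integrable_norm_pow two_ne_zero).const_mul α)
      (integrable_inner_of_memLp (memLp_coeff_smul_grad ha u) u.memLp_grad) ?_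
    filter_upwards [haα] with x hx
    rw [inner_smul_left, real_inner_self_eq_norm_sq]
    exact mul_le_mul_of_nonneg_right hx (sq_nonneg _)
  have h4 : ‖u‖ * ‖u‖ ≤ (4 * R ^ 2 + 1) * ‖u.1.snd‖ ^ 2 := by nlinarith
  refine le_trans ?_ h3
  rw [mul_assoc, div_mul_eq_mul_div, div_le_iff₀ (by positivity)]
  calc α * (‖u‖ * ‖u‖) ≤ α * ((4 * R ^ 2 + 1) * ‖u.1.snd‖ ^ 2) := by gcongr
    _ = _ := by ring

/-- The solution operator of the Lax–Milgram theorem for a form that is coercive on a closed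
subspace. -/
theorem exists_laxMilgram_solver {H : Type*} [NormedAddCommGroup H] [InnerProductSpace ℝ H]
    (V : Submodule ℝ H) [CompleteSpace V] (B : H →L[ℝ] H →L[ℝ] ℝ)
    (hB : ∃ c : ℝ, 0 < c ∧ ∀ u ∈ V, c * ‖u‖ * ‖u‖ ≤ B u u) :
    ∃ T : (H →L[ℝ] ℝ) →L[ℝ] H, ∀ ℓ, T ℓ ∈ V ∧ ∀ w ∈ V, B (T ℓ) w = ℓ w := by
  let b : V →L[ℝ] V →L[ℝ] ℝ := B.bilinearComp V.subtypeL V.subtypeL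
  have hb : IsCoercive b := by
    obtain ⟨c, hc, h⟩ := hB
    exact ⟨c, hc, fun u => h u u.2⟩
  let E := hb.continuousLinearEquivOfBilin
  -- The Riesz representative of the restriction of ℓ to V; the Lax–Milgram isomorphism is then
  -- inverted at it, so that the solution is linear and continuous in ℓ.
  let D : (H →L[ℝ] ℝ) → V := fun ℓ => (InnerProductSpace.toDual ℝ V).symm (ℓ.comp V.subtypeL)
  have hD : ∀ ℓ (w : V), inner ℝ (D ℓ) w = ℓ w := fun ℓ w => by
    simp [D]
  let D' : (H →L[ℝ] ℝ) →L[ℝ] V :=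
    { toFun := D
      map_add' := fun x y => ext_inner_right ℝ fun w => by
        rw [inner_add_left, hD, hD, hD]; rfl
      map_smul' := fun c x => ext_inner_right ℝ fun w => by
        rw [inner_smul_left, hD, hD]; rfl
      cont := (InnerProductSpace.toDual ℝ V).symm.continuous.comp
        (continuous_id.clm_comp continuous_const) }
  refine ⟨V.subtypeL.comp ((E.symm : V →L[ℝ] V).comp D'), fun ℓ => ⟨(E.symm (D ℓ)).2, ?_⟩⟩
  intro w hw
  have h1 := hb.continuousLinearEquivOfBilin_apply (E.symm (D ℓ)) ⟨w, hw⟩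
  change inner ℝ (E (E.symm (D ℓ))) _ = _ at h1
  rw [ContinuousLinearEquiv.apply_symm_apply, hD] at h1
  exact h1.symm

/-- Restriction of functions in `H¹(Ω)` to a smaller set. -/
theorem exists_restriction (hΩ : MeasurableSet Ω) (hsub : Ω' ⊆ Ω) :
    ∃ R : H1 Ω →L[ℝ] H1 Ω', ∀ u, (R u).fn =ᵐ[volume.restrict Ω'] u.fn := by
  have hle : volume.restrict Ω' ≤ (volume.restrict Ω : Measure (Rn d)) :=
    Measure.restrict_mono hsub le_rfl
  have hac := hle.absolutelyContinuous
  let r : H1 Ω → H1 Ω' := fun u =>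
    ⟨WithLp.toLp 2 ((u.memLp_fn.mono_measure hle).toLp, (u.memLp_grad.mono_measure hle).toLp), by
      have hweak : IsWeakGradient Ω' u.fn u.grad := by
        intro φ hφ
        have h := u.2 φ ⟨hφ.smooth, hφ.compact, hφ.support_subset.trans hsub⟩
        rw [setIntegral_eq_of_subset_of_forall_sdiff_eq_zero hΩ hsub,
          setIntegral_eq_of_subset_of_forall_sdiff_eq_zero hΩ hsub] at h
        · exact h
        · intro x hx
          rw [image_eq_zero_of_notMem_tsupport fun h => hx.2 (hφ.support_subset h), zero_smul]
        · intro x hx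
          rw [gradient_eq_zero_of_notMem fun h => hx.2 (hφ.support_subset h), smul_zero]
      exact hweak.congr (u.memLp_fn.mono_measure hle).coeFn_toLp
        (u.memLp_grad.mono_measure hle).coeFn_toLp⟩
  have r1 : ∀ u, (r u).1.fst =ᵐ[volume.restrict Ω'] u.fn := fun u =>
    (u.memLp_fn.mono_measure hle).coeFn_toLp
  have r2 : ∀ u, (r u).1.snd =ᵐ[volume.restrict Ω'] u.grad := fun u =>
    (u.memLp_grad.mono_measure hle).coeFn_toLp
  have hext : ∀ p q : H1 Ω', p.1.fst =ᵐ[volume.restrict Ω'] q.1.fst →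
      p.1.snd =ᵐ[volume.restrict Ω'] q.1.snd → p = q := fun p q h1 h2 =>
    Subtype.ext (WithLp.ofLp_injective 2 (Prod.ext (Lp.ext h1) (Lp.ext h2)))
  let rl : H1 Ω →ₗ[ℝ] H1 Ω' :=
    { toFun := r
      map_add' := fun u v => hext _ _
        ((r1 _).trans ((hac.ae_eq (Lp.coeFn_add u.1.fst v.1.fst)).trans
          (((r1 u).add (r1 v)).symm.trans (Lp.coeFn_add (r u).1.fst (r v).1.fst).symm)))
        ((r2 _).trans ((hac.ae_eq (Lp.coeFn_add u.1.snd v.1.snd)).trans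
          (((r2 u).add (r2 v)).symm.trans (Lp.coeFn_add (r u).1.snd (r v).1.snd).symm)))
      map_smul' := fun c u => hext _ _
        ((r1 _).trans ((hac.ae_eq (Lp.coeFn_smul c u.1.fst)).trans
          (((r1 u).const_smul c).symm.trans (Lp.coeFn_smul c (r u).1.fst).symm)))
        ((r2 _).trans ((hac.ae_eq (Lp.coeFn_smul c u.1.snd)).trans
          (((r2 u).const_smul c).symm.trans (Lp.coeFn_smul c (r u).1.snd).symm))) }
  refine ⟨rl.mkContinuous 1 fun u => ?_, r1⟩
  rw [one_mul]
  refine le_of_sq_le_sq ?_ (norm_nonneg u)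
  rw [H1.norm_sq_eq, H1.norm_sq_eq]
  have n1 : ‖(rl u).1.fst‖ ≤ ‖u.1.fst‖ := by
    change ‖(r u).1.fst‖ ≤ _
    rw [Lp.norm_def, Lp.norm_def, eLpNorm_congr_ae (r1 u)]
    exact ENNReal.toReal_mono u.memLp_fn.2.ne (eLpNorm_mono_measure _ hle)
  have n2 : ‖(rl u).1.snd‖ ≤ ‖u.1.snd‖ := by
    change ‖(r u).1.snd‖ ≤ _
    rw [Lp.norm_def, Lp.norm_def, eLpNorm_congr_ae (r2 u)]
    exact ENNReal.toReal_mono u.memLp_grad.2.ne (eLpNorm_mono_measure _ hle)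
  gcongr

theorem HasTrace.sub {u v : H1 Ω} {f g : L2bdry Ω} (hu : HasTrace u f) (hv : HasTrace v g) :
    HasTrace (u - v) (f - g) := by
  have := hu.add (hv.smul (-1))
  rwa [neg_one_smul, neg_one_smul, ← sub_eq_add_neg, ← sub_eq_add_neg] at this

/-- A bounded linear right inverse of the trace. -/
theorem exists_traceLift (hΩ : IsOpen Ω) (hΩb : Bornology.IsBounded Ω)
    (hΩL : HasLipschitzBoundary Ω) :
    ∃ E : HHalf Ω →L[ℝ] H1 Ω, ∀ f, HasTrace (E f) f.val := by
  -- All functions with a given trace form one coset of `H10`, so their component orthogonal to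
  -- `H10` depends only on the trace. This makes the lift linear whichever preimage is chosen.
  let Q := (H10 Ω)ᗮ.starProjection
  have hQ : ∀ (u v : H1 Ω) (f : L2bdry Ω), HasTrace u f → HasTrace v f → Q u = Q v := by
    intro u v f hu hv
    have h := hu.sub hv
    rw [sub_self] at h
    have h2 : Q (u - v) = 0 := by
      rw [Submodule.starProjection_apply_eq_zero_iff, Submodule.orthogonal_orthogonal]
      exact h.mem_H10 hΩ hΩb hΩL
    rwa [map_sub, sub_eq_zero] at h2
  have hQt : ∀ (u : H1 Ω) (f : L2bdry Ω), HasTrace u f → HasTrace (Q u) f := by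
    intro u f hu
    have h1 : u - Q u ∈ H10 Ω := by
      have := Submodule.sub_starProjection_mem_orthogonal (K := (H10 Ω)ᗮ) u
      rwa [Submodule.orthogonal_orthogonal] at this
    have := hu.sub (hasTrace_zero_of_mem_H10 hΩ h1)
    rwa [sub_sub_cancel, sub_zero] at this
  choose U hU using fun f : HHalf Ω =>
    (Subtype.property (p := fun g => g ∈ traceRange Ω) f : ∃ u : H1 Ω, HasTrace u f.val)
  let L : HHalf Ω →ₗ[ℝ] H1 Ω :=
    { toFun := fun f => Q (U f)
      map_add' := fun f g => by
        rw [← map_add]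
        exact hQ _ _ _ (hU (f + g)) ((hU f).add (hU g))
      map_smul' := fun c f => by
        rw [RingHom.id_apply, ← map_smul]
        exact hQ _ _ _ (hU (c • f)) ((hU f).smul c) }
  refine ⟨L.mkContinuous 1 fun f => ?_, fun f => hQt _ _ (hU f)⟩
  rw [one_mul]
  refine le_of_forall_pos_le_add fun ε hε => ?_
  obtain ⟨u, hu, hlt⟩ := HHalf.exists_norm_lt f hε
  change ‖Q (U f)‖ ≤ HHalf.traceNorm f + ε
  -- The chosen preimage is replaced by one of nearly minimal norm, which the orthogonal projection
  -- does not increase.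
  rw [hQ _ _ _ (hU f) hu]
  exact ((H10 Ω)ᗮ.norm_starProjection_apply_le u).trans hlt.le

/-- The weak form of `∇ · (a ∇u) = h`, tested with `H¹₀(Ω)`. -/
theorem isWeakDivergence_iff {a h : Rn d → ℝ}
    {B : H1 Ω →L[ℝ] H1 Ω →L[ℝ] ℝ}
    (hB : ∀ u v : H1 Ω, B u v = ∫ x in Ω, inner ℝ (a x • u.grad x) (v.grad x))
    {L : H1 Ω →L[ℝ] ℝ} (hL : ∀ w : H1 Ω, L w = ∫ x in Ω, h x * w.fn x) (u : H1 Ω) :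
    IsWeakDivergence Ω (fun x => a x • u.grad x) h ↔ ∀ w ∈ H10 Ω, B u w = - L w := by
  have e : ∀ φ (hφ : IsTestFunction Ω φ),
      (∫ x in Ω, inner ℝ (a x • u.grad x) (∇ φ x) = - ∫ x in Ω, h x * φ x) ↔
        (B u + L) hφ.toH1 = 0 := by
    intro φ hφ
    have e1 : B u hφ.toH1 = ∫ x in Ω, inner ℝ (a x • u.grad x) (∇ φ x) := by
      rw [hB]
      refine integral_congr_ae ?_
      filter_upwards [hφ.grad_toH1] with x hx
      rw [hx]
    have e2 : L hφ.toH1 = ∫ x in Ω, h x * φ x := by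
      rw [hL]
      refine integral_congr_ae ?_
      filter_upwards [hφ.fn_toH1] with x hx
      rw [hx]
    rw [← e1, ← e2, add_apply, add_eq_zero_iff_eq_neg]
  constructor
  · intro hw w hwm
    rw [← add_eq_zero_iff_eq_neg]
    exact eq_zero_of_mem_H10 (B u + L) (fun φ hφ => (e φ hφ).1 (hw φ hφ)) hwm
  · intro hw φ hφ
    refine (e φ hφ).2 ?_
    rw [add_apply, add_eq_zero_iff_eq_neg]
    exact hw _ hφ.toH1_mem

theorem zeroExtension_memLp (hΩ' : MeasurableSet Ω') (g : H1 Ω') :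
    MemLp (zeroExtension g) 2 (volume.restrict Ω) :=
  ((memLp_indicator_iff_restrict hΩ').2 g.memLp_fn).restrict Ω

theorem setIntegral_zeroExtension_mul (hΩ' : MeasurableSet Ω') (hsub : Ω' ⊆ Ω)
    (g : H1 Ω') (F : Rn d → ℝ) :
    ∫ x in Ω, zeroExtension g x * F x = ∫ x in Ω', g.fn x * F x := by
  have e : (fun x => zeroExtension g x * F x) = Ω'.indicator fun x => g.fn x * F x := by
    funext x
    by_cases hx : x ∈ Ω'
    · simp only [zeroExtension, indicator_of_mem hx]
    · simp only [zeroExtension, indicator_of_notMem hx, zero_mul]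
  rw [e, setIntegral_indicator hΩ', inter_eq_right.2 hsub]

end Dirichlet

end AdjointMap

end

/-! ### The solution operators and the adjoint identity. -/

theorem mainTheorem1 {d : ℕ} (hd : 1 ≤ d) {Ω Ω' : Set (AdjointMap.Rn d)}
    (hΩ : IsOpen Ω) (hΩb : Bornology.IsBounded Ω) (hΩL : AdjointMap.HasLipschitzBoundary Ω)
    (hΩ' : IsOpen Ω') (hsub : closure Ω' ⊆ Ω)
    {a : AdjointMap.Rn d → ℝ} (ha : AEStronglyMeasurable a (volume.restrict Ω))
    {α β : ℝ} (hα : 0 < α) (hab : ∀ᵐ x ∂(volume.restrict Ω), α ≤ a x ∧ a x ≤ β) :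
    (∀ f : AdjointMap.HHalf Ω, ∃! u : AdjointMap.H1 Ω,
      AdjointMap.IsDirichletSolution a 0 f u) ∧
    (∀ g : AdjointMap.H1 Ω', ∃! v : AdjointMap.H1 Ω,
      AdjointMap.IsDirichletSolution a (AdjointMap.zeroExtension g) 0 v) ∧
    ∃ (S : AdjointMap.HHalf Ω →L[ℝ] AdjointMap.H1 Ω')
      (Sstar : AdjointMap.H1 Ω' →L[ℝ] AdjointMap.HNegHalf Ω),
      (∀ (f : AdjointMap.HHalf Ω) (u : AdjointMap.H1 Ω),
        AdjointMap.IsDirichletSolution a 0 f u →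
          (S f).fn =ᵐ[volume.restrict Ω'] u.fn) ∧
      (∀ (g : AdjointMap.H1 Ω') (v : AdjointMap.H1 Ω),
        AdjointMap.IsDirichletSolution a (AdjointMap.zeroExtension g) 0 v →
          AdjointMap.IsBoundaryFlux a v (Sstar g)) ∧
      ∀ (f : AdjointMap.HHalf Ω) (g : AdjointMap.H1 Ω'),
        ∫ x in Ω', g.fn x * (S f).fn x = Sstar g f := by
  open AdjointMap in
  have hsub' : Ω' ⊆ Ω := subset_closure.trans hsub
  have haT : MemLp a ⊤ (volume.restrict Ω) := by
    refine memLp_top_of_bound ha β ?_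
    filter_upwards [hab] with x hx
    rw [Real.norm_of_nonneg (hα.le.trans hx.1)]
    exact hx.2
  obtain ⟨B, hB⟩ := exists_energyForm haT
  obtain ⟨c, hc, hcoer⟩ := energyForm_coercive hd hΩb haT hα (hab.mono fun x hx => hx.1) hB
  obtain ⟨T, hT⟩ := exists_laxMilgram_solver (H10 Ω) B ⟨c, hc, hcoer⟩
  obtain ⟨R, hR⟩ := exists_restriction hΩ.measurableSet hsub'
  obtain ⟨E, hE⟩ := exists_traceLift hΩ hΩb hΩL
  let L : H1 Ω' →L[ℝ] H1 Ω →L[ℝ] ℝ :=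
    (innerSL ℝ).bilinearComp (fnL Ω') ((fnL Ω').comp R)
  have hLR : ∀ g F, L g F = ∫ x in Ω', g.fn x * (R F).fn x := by
    intro g F
    change inner ℝ (fnL Ω' g) (fnL Ω' (R F)) = _
    rw [L2.inner_def]
    refine integral_congr_ae (Eventually.of_forall fun x => ?_)
    exact mul_comm _ _
  have hL : ∀ g F, L g F = ∫ x in Ω, zeroExtension g x * F.fn x := by
    intro g F
    rw [hLR, setIntegral_zeroExtension_mul hΩ'.measurableSet hsub']
    refine integral_congr_ae ?_
    filter_upwards [hR F] with x hx
    rw [hx]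
  have h0 : ∀ w : H1 Ω, (0 : H1 Ω →L[ℝ] ℝ) w = ∫ x in Ω, (0 : Rn d → ℝ) x * w.fn x := by
    intro w
    simp
  have huniq : ∀ (h : Rn d → ℝ) (ℓ : H1 Ω →L[ℝ] ℝ), (∀ w, ℓ w = ∫ x in Ω, h x * w.fn x) →
      ∀ (f : HHalf Ω) (u v : H1 Ω), IsDirichletSolution a h f u → IsDirichletSolution a h f v →
        u = v := by
    intro h ℓ hℓ f u v hu hv
    have htr := hu.2.sub hv.2
    rw [sub_self] at htr
    have hmem := htr.mem_H10 hΩ hΩb hΩL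
    have h1 := (isWeakDivergence_iff hB hℓ u).1 hu.1 _ hmem
    have h2 := (isWeakDivergence_iff hB hℓ v).1 hv.1 _ hmem
    have h3 : B (u - v) (u - v) = 0 := by
      rw [map_sub B, sub_apply, h1, h2, sub_self]
    have h4 := hcoer _ hmem
    rw [h3, mul_assoc] at h4
    have h5 : ‖u - v‖ * ‖u - v‖ ≤ 0 := nonpos_of_mul_nonpos_right h4 hc
    have h6 : ‖u - v‖ = 0 := by nlinarith [norm_nonneg (u - v)]
    exact sub_eq_zero.1 (norm_eq_zero.1 h6)
  -- The lift is corrected by the element of `H10` having the same energy pairings with `H10`; the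
  -- trace is unchanged and the equation becomes homogeneous.
  let P : HHalf Ω →L[ℝ] H1 Ω := E - (T.comp B).comp E
  have hP : ∀ f, IsDirichletSolution a 0 f (P f) := by
    intro f
    refine ⟨(isWeakDivergence_iff hB h0 _).2 fun w hw => ?_, ?_⟩
    · change B (E f - T (B (E f))) w = _
      rw [map_sub, sub_apply, (hT _).2 w hw]
      simp
    · have := (hE f).sub (hasTrace_zero_of_mem_H10 hΩ (hT (B (E f))).1)
      rwa [sub_zero] at this
  let V : H1 Ω' →L[ℝ] H1 Ω := T.comp (-L)
  have hVmem : ∀ g, V g ∈ H10 Ω := fun g => (hT _).1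
  have hVB : ∀ g, ∀ w ∈ H10 Ω, B (V g) w = - L g w := fun g w hw => (hT _).2 w hw
  have hV : ∀ g, IsDirichletSolution a (zeroExtension g) 0 (V g) := fun g =>
    ⟨(isWeakDivergence_iff hB (hL g) _).2 (hVB g), hasTrace_zero_of_mem_H10 hΩ (hVmem g)⟩
  -- The flux formula evaluated on the fixed lift `E`, which makes linearity and continuity
  -- immediate.
  let Sstar : H1 Ω' →L[ℝ] HNegHalf Ω :=
    (ContinuousLinearMap.precomp ℝ E).comp (B.comp V + L)
  have hS : ∀ g f, Sstar g f = B (V g) (E f) + L g (E f) := fun g f => rfl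
  refine ⟨fun f => ⟨P f, hP f, fun u hu => huniq _ _ h0 f _ _ hu (hP f)⟩,
    fun g => ⟨V g, hV g, fun v hv => huniq _ _ (hL g) 0 _ _ hv (hV g)⟩,
    R.comp P, Sstar, fun f u hu => ?_, fun g v hv => ?_, fun f g => ?_⟩
  · rw [huniq _ _ h0 f _ _ hu (hP f)]
    exact hR _
  · rw [huniq _ _ (hL g) 0 _ _ hv (hV g)]
    refine ⟨memLp_coeff_smul_grad haT _, zeroExtension g,
      zeroExtension_memLp hΩ'.measurableSet g, (hV g).1, fun f F hF => ?_⟩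
    have i1 := integrable_inner_of_memLp (memLp_coeff_smul_grad haT (V g)) F.memLp_grad
    have i2 : Integrable (fun x => zeroExtension g x * F.fn x) (volume.restrict Ω) :=
      (zeroExtension_memLp hΩ'.measurableSet g).integrable_mul F.memLp_fn
    refine Eq.trans ?_ (integral_add i1 i2).symm
    rw [← hB, ← hL, hS]
    have htr := hF.sub (hE f)
    rw [sub_self] at htr
    -- F and `E f` share a trace, so their difference is admissible in the weak equation for `V g`;
    -- hence the flux formula takes the same value on both.
    have h1 := hVB g _ (htr.mem_H10 hΩ hΩb hΩL)
    rw [map_sub, map_sub] at h1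
    linarith
  · rw [hS, ContinuousLinearMap.comp_apply, ← hLR]
    have hw := hT (B (E f))
    have h1 := hVB g _ hw.1
    have h2 := hw.2 _ (hVmem g)
    rw [energyForm_symm hB] at h2
    -- With w = `T (B (E f))`: B(Vg, Ef) = B(Vg, w) because `V g` lies in `H10`, and this equals
    -- −∫gw because w does.
    rw [energyForm_symm hB (V g) (E f), ← h2, h1]
    change L g (E f - T (B (E f))) = _
    rw [map_sub]
    ring
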